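/- Let $(X,\mathcal A,\mu)$ be a probability space (for example a Lebesgue space) and let $\{T^z\}_{z\in\mathbb Z^2}$ be a $\mathbb Z^2$-action on it by invertible (mod $0$) measure preserving maps, with $T^{z}\circ T^{w}=T^{z+w}$ $\mu$-almost everywhere. Put $\hat T^z f=f\circ T^z$ on the complex space $L_2(X,\mu)$; let $I$ be the identity operator, $\Theta$ the orthogonal projection of $L_2(X,\mu)$ onto the constants, and, for any probability space $(Y,\nu)$, let $L_2^0(Y,\nu)$ be the orthogonal complement of the constants in $L_2(Y,\nu)$. For a $\mathbb Z^2$-action $\{S^z\}$ on $(Y,\nu)$ a cyclic subspace is the closed linear span of $\{\hat S^z h : z\in\mathbb Z^2\}$ for some $h\in L_2(Y,\nu)$. The action has simple spectrum if $L_2^0(Y,\nu)$ is a cyclic subspace; it has homogeneous spectrum of multiplicity $n$ if $L_2^0(Y,\nu)$ is an orthogonal sum $\bigoplus_{i=1}^n C_i$ of cyclic subspaces $C_i$ such that the restrictions of $\{\hat S^z\}$ to the $C_i$ are pairwise unitarily isomorphic. Suppose that $\{T^z\}$ is totally ergodic, i.e. $T^z$ is ergodic for every $z\neq 0$, that 1.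 $\{T^z\}$ has simple spectrum, and 2. for $m_1=(1,0)$, $m_2=(0,1)$, $m_3=(1,1)$ and each $j\in\{1,2,3\}$ there are positive numbers $a_j,b_j,c_j$ with $a_j+b_j+c_j=1$ and a sequence $(p_i)$ in $\mathbb Z^2$ such that $\hat T^{p_i}\to a_jI+b_j\hat T^{m_j}+c_j\Theta$ in the weak operator topology as $i\to\infty$. Then the diagonal action $\{T^z\times T^z\}_{z\in\mathbb Z^2}$ on $(X\times X,\mu\times\mu)$ has homogeneous spectrum of multiplicity two. -/

import Mathlib

open MeasureTheory Filter Topology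

noncomputable section

namespace Z2Spectrum

/-- A measure preserving `ℤ²`-action on `(X, μ)` by automorphisms. As usual in the theory of
Lebesgue spaces, maps are considered up to null sets, so the group law is required almost
everywhere; `map_zero` and `map_add` make every `T^z` invertible mod 0 with inverse `T^{-z}`. -/
structure Action {X : Type*} [MeasurableSpace X] (μ : Measure X) where
  toFun : ℤ × ℤ → X → X
  measurePreserving : ∀ z, MeasurePreserving (toFun z) μ μ
  map_zero : toFun 0 =ᵐ[μ] id
  map_add : ∀ z w, toFun (z + w) =ᵐ[μ] toFun z ∘ toFun w

section Operators

variable {H : Type*} [NormedAddCommGroup H] [InnerProductSpace ℂ H]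

/-- `C` is the closed linear span of the orbit `{U^z h}` of some vector `h`. -/
def IsCyclicSubspace (U : ℤ × ℤ → H →ₗᵢ[ℂ] H) (C : Submodule ℂ H) : Prop :=
  ∃ h : H, (Submodule.span ℂ (Set.range fun z => U z h)).topologicalClosure = C

/-- `C` is invariant, and some unitary isomorphism of `C` onto `D` intertwines the restrictions of
`{U^z}` to `C` and to `D` (so that `D` is invariant as well). -/
def RestrictionsIsomorphic (U : ℤ × ℤ → H →ₗᵢ[ℂ] H) (C D : Submodule ℂ H) : Prop :=
  ∃ (hC : ∀ z, ∀ x ∈ C, U z x ∈ C) (V : C ≃ₗᵢ[ℂ] D),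
    ∀ (z : ℤ × ℤ) (x : C), (V ⟨U z x, hC z x x.2⟩ : H) = U z (V x : H)

/-- The operator `A` is the limit of some sequence `U^{p_i}` in the weak operator topology. -/
def HasWeakLimit (U : ℤ × ℤ → H →ₗᵢ[ℂ] H) (A : H →L[ℂ] H) : Prop :=
  ∃ p : ℕ → ℤ × ℤ, ∀ f g : H,
    Tendsto (fun i => inner ℂ g (U (p i) f)) atTop (𝓝 (inner ℂ g (A f)))

end Operators

section Measure

variable {X : Type*} [MeasurableSpace X]

/-- The constant functions in `L²(X, μ)`. -/
def constants (μ : Measure X) [IsFiniteMeasure μ] : Submodule ℂ (Lp ℂ 2 μ) :=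
  Submodule.span ℂ {Lp.const 2 μ (1 : ℂ)}

instance (μ : Measure X) [IsFiniteMeasure μ] : (constants μ).HasOrthogonalProjection := by
  unfold constants
  infer_instance

/-- The space `L²₀(X, μ)`, the orthogonal complement of the constants. -/
def L20 (μ : Measure X) [IsFiniteMeasure μ] : Submodule ℂ (Lp ℂ 2 μ) :=
  (constants μ)ᗮ

/-- The orthogonal projection `Θ` of `L²(X, μ)` onto the constants. -/
def Theta (μ : Measure X) [IsFiniteMeasure μ] : Lp ℂ 2 μ →L[ℂ] Lp ℂ 2 μ :=
  (constants μ).starProjection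

namespace Action

variable {μ : Measure X}

/-- The operator `f ↦ f ∘ T^z` on `L²(X, μ)`. -/
def koopman (T : Action μ) (z : ℤ × ℤ) : Lp ℂ 2 μ →ₗᵢ[ℂ] Lp ℂ 2 μ :=
  Lp.compMeasurePreservingₗᵢ ℂ (T.toFun z) (T.measurePreserving z)

/-- Every element of the action other than the identity element is ergodic. -/
def IsTotallyErgodic (T : Action μ) : Prop :=
  ∀ z, z ≠ 0 → Ergodic (T.toFun z) μ

def HasSimpleSpectrum [IsFiniteMeasure μ] (T : Action μ) : Prop :=
  IsCyclicSubspace T.koopman (L20 μ)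

/-- Homogeneous spectrum of multiplicity `n`: `L²₀` is the orthogonal sum of `n` cyclic
subspaces on which the action restricts to pairwise isomorphic actions. -/
def HasHomogeneousSpectrum [IsFiniteMeasure μ] (T : Action μ) (n : ℕ) : Prop :=
  ∃ C : Fin n → Submodule ℂ (Lp ℂ 2 μ),
    (∀ i, IsCyclicSubspace T.koopman (C i)) ∧
    (Pairwise fun i j => C i ⟂ C j) ∧
    (⨆ i, C i) = L20 μ ∧
    ∀ i j, RestrictionsIsomorphic T.koopman (C i) (C j)

/-- The diagonal action `{T^z × T^z}` on `(X × X, μ × μ)`. -/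
def diag [SFinite μ] (T : Action μ) : Action (μ.prod μ) where
  toFun z := Prod.map (T.toFun z) (T.toFun z)
  measurePreserving z := (T.measurePreserving z).prod (T.measurePreserving z)
  map_zero := by
    filter_upwards [Measure.quasiMeasurePreserving_fst.ae T.map_zero,
      Measure.quasiMeasurePreserving_snd.ae T.map_zero] with x h1 h2
    exact Prod.ext h1 h2
  map_add z w := by
    filter_upwards [Measure.quasiMeasurePreserving_fst.ae (T.map_add z w),
      Measure.quasiMeasurePreserving_snd.ae (T.map_add z w)] with x h1 h2
    exact Prod.ext h1 h2

end Action

end Measure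

end Z2Spectrum

end

/-!
Write `L = L²(μ)`, let `U` be the representation of `ℤ²` on `L`, let `L₀` be the orthogonal
complement of the constants and let `h` be a cyclic vector of `L₀`. Then `L²(μ × μ)` is the Hilbert
tensor product `L ⊗ L` and the diagonal action is `z ↦ U^z ⊗ U^z`.

*Symmetric vectors.* Suppose that `x ∈ L₀ ⊗ L₀` is the image, under an operator commuting with the
diagonal action, of `f ⊗ 1 + 1 ⊗ f` with `f ∈ L₀`. With `Z = U^m ⊗ 1` and `W = 1 ⊗ U^m`, the weak
limit for `m` acts on `f ⊗ 1 + 1 ⊗ f` as `a + b Z W` and on `L₀ ⊗ L₀` as `(a + b Z) (a + b W)`, so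
the two agree at `x`. This expresses `W x` as a Möbius transform of `Z` applied to `x`, so that `x`
is fixed by `v ⊗ U^m` for some unitary `v`. Applied to the generators of `ℤ²`, this makes `x` a
fixed vector of some `v_q ⊗ U^q` for every `q`. As the operators `U^q` have a weak limit of norm
less than one on `L₀`, this forces `x = 0`. Hence the cyclic space of `h ⊗ 1 + 1 ⊗ h + h ⊗ h`
contains `h ⊗ 1 + 1 ⊗ h` and `h ⊗ h`. The limit on `L₀ ⊗ L₀` also shows that closed diagonally
invariant subspaces of `L₀ ⊗ L₀` are stable under `U^m ⊗ 1 + 1 ⊗ U^m` for the three given `m`, and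
then for all `m ∈ ℤ²` by an addition formula of Chebyshev type. Hence this cyclic space consists of
all symmetric vectors orthogonal to the constants.

*Antisymmetric vectors.* The operators `U^m ⊗ 1 - 1 ⊗ U^m` are normal, commute with the diagonal
action and anticommute with the flip. Those for `(1, 0)` and `(0, 1)` combine into one such
operator whose kernel is exactly the constants, again because no nonzero vector of `L ⊗ L₀` is
fixed by all `U^{-q} ⊗ U^q`. The unitary part of its polar decomposition carries the symmetric
vectors onto the antisymmetric ones.
-/

noncomputable section

namespace Z2Spectrum

open scoped TensorProduct InnerProductSpace

section HilbertSpace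

variable {𝕜 K K' : Type*} [RCLike 𝕜] [NormedAddCommGroup K] [InnerProductSpace 𝕜 K]
  [NormedAddCommGroup K'] [InnerProductSpace 𝕜 K']

theorem closure_span_le {s : Set K} {C : Submodule 𝕜 K} (hC : IsClosed (C : Set K)) (h : s ⊆ C) :
    (Submodule.span 𝕜 s).topologicalClosure ≤ C :=
  Submodule.topologicalClosure_minimal _ (Submodule.span_le.2 h) hC

theorem subset_closure_span (s : Set K) : s ⊆ (Submodule.span 𝕜 s).topologicalClosure :=
  Submodule.subset_span.trans (Submodule.le_topologicalClosure _)

theorem map_mem_of_mem_closure_span (A : K →L[𝕜] K') {s : Set K} {C : Submodule 𝕜 K'}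
    (hC : IsClosed (C : Set K')) (h : ∀ x ∈ s, A x ∈ C) {x : K}
    (hx : x ∈ (Submodule.span 𝕜 s).topologicalClosure) : A x ∈ C :=
  closure_span_le (C := C.comap A.toLinearMap) (hC.preimage A.continuous) h hx

theorem starProjection_apply_comm {F : Type*} [FunLike F K K] [AddMonoidHomClass F K K]
    {C : Submodule 𝕜 K} [C.HasOrthogonalProjection] {B : F} {B' : K → K}
    (hadj : ∀ x y, ⟪B' x, y⟫_𝕜 = ⟪x, B y⟫_𝕜) (hB : ∀ x ∈ C, B x ∈ C) (hB' : ∀ x ∈ C, B' x ∈ C)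
    (x : K) : C.starProjection (B x) = B (C.starProjection x) := by
  refine Submodule.eq_starProjection_of_mem_of_inner_eq_zero
    (hB _ (Submodule.starProjection_apply_mem _ _)) fun w hw => ?_
  rw [← inner_conj_symm, ← map_sub, ← hadj, inner_conj_symm]
  exact Submodule.starProjection_inner_eq_zero _ _ (hB' w hw)

theorem mem_of_add_mem_of_inner_starProjection_eq_zero (C : Submodule 𝕜 K)
    [C.HasOrthogonalProjection] {w s : K} (hws : w + s ∈ C) (h : ⟪s, w⟫_𝕜 = 0)
    (h' : ⟪s, C.starProjection w⟫_𝕜 = 0) : w ∈ C := by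
  have hPs : C.starProjection s = w + s - C.starProjection w := by
    rw [eq_sub_iff_add_eq', ← map_add, Submodule.starProjection_eq_self_iff.2 hws]
  have hs : ⟪s, C.starProjection s⟫_𝕜 = ⟪s, s⟫_𝕜 := by
    rw [hPs, inner_sub_right, inner_add_right, h, h', zero_add, sub_zero]
  have hsC : s - C.starProjection s = 0 := by
    rw [← inner_self_eq_zero (𝕜 := 𝕜), inner_sub_left, inner_sub_right, hs, sub_self, zero_sub,
      neg_eq_zero, ← inner_conj_symm, Submodule.starProjection_inner_eq_zero _ _
        (Submodule.starProjection_apply_mem _ _), map_zero]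
  rw [sub_eq_zero, eq_comm, Submodule.starProjection_eq_self_iff] at hsC
  simpa using C.sub_mem hws hsC

end HilbertSpace

section WeakConvergence

variable (𝕜 : Type*) {K K' ι : Type*} [RCLike 𝕜] [NormedAddCommGroup K] [InnerProductSpace 𝕜 K]
  [NormedAddCommGroup K'] [InnerProductSpace 𝕜 K'] {l : Filter ι}

/-- Weak convergence of vectors of a Hilbert space, tested against inner products. -/
def WeakTendsto (x : ι → K) (l : Filter ι) (y : K) : Prop :=
  ∀ g, Tendsto (fun i => ⟪g, x i⟫_𝕜) l (𝓝 ⟪g, y⟫_𝕜)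

variable {𝕜}

theorem WeakTendsto.unique [l.NeBot] {x : ι → K} {y z : K} (hy : WeakTendsto 𝕜 x l y)
    (hz : WeakTendsto 𝕜 x l z) : y = z :=
  ext_inner_left 𝕜 fun g => tendsto_nhds_unique (hy g) (hz g)

theorem WeakTendsto.add {x x' : ι → K} {y y' : K} (h : WeakTendsto 𝕜 x l y)
    (h' : WeakTendsto 𝕜 x' l y') : WeakTendsto 𝕜 (fun i => x i + x' i) l (y + y') := fun g => by
  simpa only [inner_add_right] using (h g).add (h' g)

theorem WeakTendsto.map [CompleteSpace K] [CompleteSpace K'] (A : K →L[𝕜] K') {x : ι → K} {y : K}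
    (h : WeakTendsto 𝕜 x l y) : WeakTendsto 𝕜 (fun i => A (x i)) l (A y) := fun g => by
  simpa only [ContinuousLinearMap.adjoint_inner_left] using h (A.adjoint g)

theorem WeakTendsto.mem [l.NeBot] {C : Submodule 𝕜 K} [C.HasOrthogonalProjection] {x : ι → K}
    {y : K} (h : WeakTendsto 𝕜 x l y) (hx : ∀ i, x i ∈ C) : y ∈ C := by
  rw [← Submodule.orthogonal_orthogonal C, Submodule.mem_orthogonal]
  intro g hg
  refine tendsto_nhds_unique (h g) ?_
  simp only [Submodule.inner_left_of_mem_orthogonal (hx _) hg, tendsto_const_nhds]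

theorem tendsto_apply_of_mem_closure_span {F : Type*} [NormedAddCommGroup F] [NormedSpace 𝕜 F]
    {O : ι → K →L[𝕜] F} {A : K →L[𝕜] F} {M : ℝ} (hM : ∀ i, ‖O i‖ ≤ M) {s : Set K}
    (hs : ∀ x ∈ s, Tendsto (fun i => O i x) l (𝓝 (A x))) {x : K}
    (hx : x ∈ (Submodule.span 𝕜 s).topologicalClosure) :
    Tendsto (fun i => O i x) l (𝓝 (A x)) := by
  have equicontinuous_iff : (∃ M, ∀ i, ‖O i‖ ≤ M) ↔ Equicontinuous fun i x => O i x :=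
    (NormedSpace.equicontinuous_TFAE O).out 5 1
  let S : Submodule 𝕜 K :=
    { carrier := {x | Tendsto (fun i => O i x) l (𝓝 (A x))}
      zero_mem' := by simp [tendsto_const_nhds]
      add_mem' := fun hx hy => by simpa using hx.add hy
      smul_mem' := fun c x hx => by simpa using hx.const_smul c }
  exact closure_span_le (C := S)
    ((equicontinuous_iff.1 ⟨M, hM⟩).isClosed_setOfPred_tendsto A.continuous) hs hx

theorem weakTendsto_of_closure_span_eq_top {x : ι → K} {y : K} {M : ℝ} (hM : ∀ i, ‖x i‖ ≤ M)
    {s : Set K} (hs : (Submodule.span 𝕜 s).topologicalClosure = ⊤)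
    (h : ∀ g ∈ s, Tendsto (fun i => ⟪g, x i⟫_𝕜) l (𝓝 ⟪g, y⟫_𝕜)) : WeakTendsto 𝕜 x l y := by
  have hconj {g : K} : Tendsto (fun i => ⟪x i, g⟫_𝕜) l (𝓝 ⟪y, g⟫_𝕜) ↔
      Tendsto (fun i => ⟪g, x i⟫_𝕜) l (𝓝 ⟪g, y⟫_𝕜) := by
    constructor <;> intro h <;>
      simpa only [Function.comp_def, inner_conj_symm] using
        (RCLike.continuous_conj.tendsto _).comp h
  intro g
  refine hconj.1 (tendsto_apply_of_mem_closure_span (O := fun i => innerSL 𝕜 (x i))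
    (A := innerSL 𝕜 y) (fun i => (innerSL_apply_norm 𝕜 (x i)).trans_le (hM i))
    (fun g hg => hconj.2 (h g hg)) (hs ▸ Submodule.mem_top : g ∈ _))

theorem weakTendsto_apply_of_mem_closure_span {O : ι → K →L[𝕜] K'} {A : K →L[𝕜] K'} {M : ℝ}
    (hM : ∀ i, ‖O i‖ ≤ M) {s : Set K} (hs : ∀ x ∈ s, WeakTendsto 𝕜 (fun i => O i x) l (A x))
    {x : K} (hx : x ∈ (Submodule.span 𝕜 s).topologicalClosure) :
    WeakTendsto 𝕜 (fun i => O i x) l (A x) := fun g =>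
  tendsto_apply_of_mem_closure_span (O := fun i => innerSL 𝕜 g ∘L O i) (A := innerSL 𝕜 g ∘L A)
    (fun i => (ContinuousLinearMap.opNorm_comp_le _ _).trans
      (mul_le_mul_of_nonneg_left (hM i) (norm_nonneg _))) (fun x hx => hs x hx g) hx

end WeakConvergence

section NormalOperators

variable {𝕜 K : Type*} [RCLike 𝕜] [NormedAddCommGroup K] [InnerProductSpace 𝕜 K]

theorem apply_mem_ker_of_commute {d₁ d₂ : K →L[𝕜] K} (h : Commute d₁ d₂) {x : K} (hx : x ∈ d₁.ker) :
    d₂ x ∈ d₁.ker := by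
  have hcomm : d₁ (d₂ x) = d₂ (d₁ x) := DFunLike.congr_fun h.eq x
  have hx0 : d₁ x = 0 := hx
  exact hcomm.trans (by rw [hx0, map_zero])

variable [CompleteSpace K]

theorem starProjection_ker_apply_apply {d : K →L[𝕜] K} (hd : IsStarNormal d) (x : K) :
    d.ker.starProjection (d x) = 0 := by
  rw [Submodule.starProjection_apply_eq_zero_iff,
    ← ContinuousLinearMap.IsStarNormal.orthogonal_range hd]
  exact Submodule.le_orthogonal_orthogonal _ ⟨x, rfl⟩

/-- For commuting normal operators `d₁` and `d₂`, a normal operator whose kernel is the common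
kernel of `d₁` and `d₂`: it acts as `d₁` on `(ker d₁)ᗮ` and as `d₂` on `ker d₁`. -/
def normalJoin (d₁ d₂ : K →L[𝕜] K) : K →L[𝕜] K :=
  d₁ + d₂ ∘L d₁.ker.starProjection

theorem normalJoin_apply (d₁ d₂ : K →L[𝕜] K) (x : K) :
    normalJoin d₁ d₂ x = d₁ x + d₂ (d₁.ker.starProjection x) := rfl

variable {d₁ d₂ : K →L[𝕜] K}

theorem starProjection_ker_comm (h : Commute d₁ d₂) (h' : Commute d₁ (star d₂)) (x : K) :
    d₁.ker.starProjection (d₂ x) = d₂ (d₁.ker.starProjection x) :=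
  starProjection_apply_comm (B := d₂) (B' := (star d₂ : K →L[𝕜] K))
    (fun x y => ContinuousLinearMap.adjoint_inner_left d₂ y x)
    (fun _ => apply_mem_ker_of_commute h) (fun _ => apply_mem_ker_of_commute h') x

theorem mem_ker_normalJoin (hd₁ : IsStarNormal d₁) (h : Commute d₁ d₂) (h' : Commute d₁ (star d₂))
    {x : K} : normalJoin d₁ d₂ x = 0 ↔ d₁ x = 0 ∧ d₂ x = 0 := by
  have hfix (hx : d₁ x = 0) : d₁.ker.starProjection x = x :=
    Submodule.starProjection_eq_self_iff.2 hx
  rw [normalJoin_apply]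
  constructor
  · intro hx
    have h₂ : d₂ (d₁.ker.starProjection x) = 0 := by
      have hP := congrArg d₁.ker.starProjection hx
      rwa [map_add, starProjection_ker_apply_apply hd₁, zero_add, starProjection_ker_comm h h',
        Submodule.starProjection_eq_self_iff.2 (Submodule.starProjection_apply_mem _ _),
        map_zero] at hP
    have h₁ : d₁ x = 0 := by rwa [h₂, add_zero] at hx
    exact ⟨h₁, by rwa [hfix h₁] at h₂⟩
  · rintro ⟨h₁, h₂⟩
    rw [hfix h₁, h₁, h₂, add_zero]

theorem isStarNormal_normalJoin (hd₁ : IsStarNormal d₁) (hd₂ : IsStarNormal d₂)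
    (h : Commute d₁ d₂) (h' : Commute d₁ (star d₂)) : IsStarNormal (normalJoin d₁ d₂) := by
  set P := d₁.ker.starProjection
  have star_P : star P = P := isSelfAdjoint_starProjection _
  have hP : Commute P d₂ := ContinuousLinearMap.ext (starProjection_ker_comm h h')
  have hP' : Commute P (star d₂) := by simpa only [star_P] using hP.star_star
  have P_mul : P * d₁ = 0 := ContinuousLinearMap.ext (starProjection_ker_apply_apply hd₁)
  have mul_P : d₁ * P = 0 :=
    ContinuousLinearMap.ext fun x => Submodule.starProjection_apply_mem d₁.ker x
  have star_mul_P : star d₁ * P = 0 := by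
    simpa only [star_mul, star_P, star_zero] using congrArg star P_mul
  have P_mul_star : P * star d₁ = 0 := by
    simpa only [star_mul, star_P, star_zero] using congrArg star mul_P
  have h₁₂ : Commute (star d₁) (d₂ * P) := by
    rw [commute_iff_eq, mul_assoc, P_mul_star, mul_zero, ← hP.eq, ← mul_assoc, star_mul_P, zero_mul]
  have h₂₁ : Commute (P * star d₂) d₁ := by
    simpa only [star_mul, star_P, star_star] using h₁₂.star_star.symm
  have h₂₂ : Commute (P * star d₂) (d₂ * P) :=
    (hP.mul_right (Commute.refl P)).mul_left (hd₂.star_comm_self.mul_right hP'.symm)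
  have star_join : star (normalJoin d₁ d₂) = star d₁ + P * star d₂ := by
    change star (d₁ + d₂ * P) = _
    rw [star_add, star_mul, star_P]
  exact ⟨star_join ▸ (hd₁.star_comm_self.add_right h₁₂).add_left (h₂₁.add_right h₂₂)⟩

theorem normalJoin_apply_of_semiconj {c : 𝕜} (hc : c ≠ 0) {u : K ≃ₗᵢ[𝕜] K}
    (h₁ : ∀ x, d₁ (u x) = c • u (d₁ x)) (h₂ : ∀ x, d₂ (u x) = c • u (d₂ x)) (x : K) :
    normalJoin d₁ d₂ (u x) = c • u (normalJoin d₁ d₂ x) := by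
  have hker (y : K) : u y ∈ d₁.ker ↔ y ∈ d₁.ker := by
    change d₁ (u y) = 0 ↔ d₁ y = 0
    rw [h₁, smul_eq_zero_iff_right hc, map_eq_zero_iff u u.injective]
  have hP : d₁.ker.starProjection (u x) = u (d₁.ker.starProjection x) :=
    starProjection_apply_comm (B := u) (B' := u.symm)
      (fun x y => by rw [← u.inner_map_map, u.apply_symm_apply]) (fun y => (hker y).2)
      (fun y hy => (hker _).1 (by rwa [u.apply_symm_apply])) x
  rw [normalJoin_apply, normalJoin_apply, h₁, hP, h₂, map_add, smul_add]

end NormalOperators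

section UnitaryRelations

variable {K : Type*} [NormedAddCommGroup K] [InnerProductSpace ℂ K]

theorem bijective_smul_sub [CompleteSpace K] {c : ℂ} (hc : ‖c‖ ≠ 1) (u : K ≃ₗᵢ[ℂ] K) :
    Function.Bijective fun x => c • x - u x := by
  let w : unitary (K →L[ℂ] K) := Unitary.linearIsometryEquiv.symm u
  have hmem : c ∈ resolventSet ℂ (w : K →L[ℂ] K) := by
    by_contra h
    exact hc (mem_sphere_zero_iff_norm.1 (Unitary.spectrum_subset_circle w h))
  rw [spectrum.mem_resolventSet_iff, ContinuousLinearMap.isUnit_iff_bijective] at hmem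
  exact hmem

theorem norm_sub_smul_eq_norm_smul_sub (c : ℂ) {x y : K} (h : ‖x‖ = ‖y‖) :
    ‖x - star c • y‖ = ‖c • x - y‖ := by
  rw [← sq_eq_sq₀ (norm_nonneg _) (norm_nonneg _), norm_sub_sq (𝕜 := ℂ), norm_sub_sq (𝕜 := ℂ),
    norm_smul, norm_smul, inner_smul_left, inner_smul_right, norm_star, h, starRingEnd_apply]
  ring

theorem exists_moebius_transform [CompleteSpace K] {c : ℂ} (hc : ‖c‖ ≠ 1) (u : K ≃ₗᵢ[ℂ] K) :
    ∃ v : K ≃ₗᵢ[ℂ] K, ∀ x, v x - star c • u (v x) = c • x - u x := by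
  have hbij : Function.Bijective fun x => x - star c • u x := by
    convert (Equiv.neg K).bijective.comp (u.bijective.comp
      (bijective_smul_sub (norm_star c ▸ hc : ‖star c‖ ≠ 1) u.symm)) using 2 with x
    simp only [Function.comp_apply, Equiv.neg_apply, map_sub, map_smul, u.apply_symm_apply, neg_sub]
  let P : K ≃ₗ[ℂ] K := .ofBijective (.id - star c • u.toLinearEquiv.toLinearMap) hbij
  let N : K ≃ₗ[ℂ] K :=
    .ofBijective (c • .id - u.toLinearEquiv.toLinearMap) (bijective_smul_sub hc u)
  have norm_N (x : K) : ‖N x‖ = ‖P x‖ :=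
    (norm_sub_smul_eq_norm_smul_sub c (u.norm_map x).symm).symm
  refine ⟨⟨P.symm.trans N, fun x => by rw [LinearEquiv.trans_apply, norm_N, P.apply_symm_apply]⟩,
    fun x => ?_⟩
  obtain ⟨y, rfl⟩ := P.surjective x
  change P (N (P.symm (P y))) = N (P y)
  rw [P.symm_apply_apply]
  change c • y - u y - star c • u (c • y - u y) = c • (y - star c • u y) - u (y - star c • u y)
  simp only [map_sub, map_smul, smul_sub, smul_comm c (star c)]
  abel

theorem eq_zero_of_eq_smul_apply {c : ℂ} (hc : ‖c‖ ≠ 1) (u : K ≃ₗᵢ[ℂ] K) {x : K}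
    (h : x = c • u x) : x = 0 := by
  by_contra hx
  have hnorm := congrArg norm h
  rw [norm_smul, u.norm_map] at hnorm
  exact hc (mul_right_cancel₀ (norm_ne_zero_iff.2 hx) (by rw [one_mul, ← hnorm]))

theorem eq_of_norm_sub_smul_eq {A B : ℝ} (hAB : 2 < A + B) {x y : K} (hx : x ≠ 0) (h : ‖x‖ = ‖y‖)
    (heq : ‖x - (B : ℂ) • y‖ = ‖(A : ℂ) • x - y‖) : A = B := by
  have hre : (⟪x, y⟫_ℂ).re ≤ ‖x‖ ^ 2 :=
    (re_inner_le_norm (𝕜 := ℂ) x y).trans_eq (by rw [← h, sq])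
  have hsq : (A - B) * ((A + B) * ‖x‖ ^ 2 - 2 * (⟪x, y⟫_ℂ).re) = 0 := by
    rw [← sq_eq_sq₀ (norm_nonneg _) (norm_nonneg _), norm_sub_sq (𝕜 := ℂ), norm_sub_sq (𝕜 := ℂ),
      norm_smul, norm_smul, inner_smul_left, inner_smul_right, ← h, Complex.conj_ofReal, mul_pow,
      mul_pow, Complex.norm_real, Complex.norm_real, Real.norm_eq_abs, Real.norm_eq_abs, sq_abs,
      sq_abs] at heq
    simp only [RCLike.re_to_complex, Complex.re_ofReal_mul] at heq
    linarith
  have hpos : 0 < ‖x‖ ^ 2 := pow_pos (norm_pos_iff.2 hx) 2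
  refine sub_eq_zero.1 ((mul_eq_zero.1 hsq).resolve_right fun h0 => ?_)
  nlinarith

theorem exists_apply_sub_smul_eq {a b : ℝ} (ha : 0 < a) (hb : 0 < b) (hab : a + b < 1)
    {Z W : K ≃ₗᵢ[ℂ] K} {x : K} (hx : x ≠ 0)
    (h : (a : ℂ) • x + (b : ℂ) • W (Z x) =
      (a : ℂ) ^ 2 • x + (a * b : ℂ) • (Z x + W x) + (b : ℂ) ^ 2 • W (Z x)) :
    ∃ c : ℝ, 1 < c ∧ W (x - (c : ℂ) • Z x) = (c : ℂ) • x - Z x := by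
  have hA : 1 < (1 - a) / b := by rw [lt_div_iff₀ hb]; linarith
  have hB : 1 < (1 - b) / a := by rw [lt_div_iff₀ ha]; linarith
  have hfactor : W (x - (((1 - b) / a : ℝ) : ℂ) • Z x) = (((1 - a) / b : ℝ) : ℂ) • x - Z x := by
    have ha₀ : (a : ℂ) ≠ 0 := mod_cast ha.ne'
    have hb₀ : (b : ℂ) ≠ 0 := mod_cast hb.ne'
    rw [← sub_eq_zero] at h ⊢
    refine smul_right_injective K (mul_ne_zero ha₀ hb₀) ?_
    beta_reduce
    rw [smul_zero, ← neg_eq_zero.2 h, map_sub, map_smul]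
    push_cast
    match_scalars <;> field_simp
  have hcoeff : (1 - a) / b = (1 - b) / a :=
    eq_of_norm_sub_smul_eq (by linarith) hx (Z.norm_map x).symm <| by
      rw [← hfactor, LinearIsometryEquiv.norm_map]
  exact ⟨(1 - a) / b, hA, by rw [← hfactor, hcoeff]⟩

end UnitaryRelations

section Lattice

theorem add_zsmul_mem {G : Type*} [AddCommGroup G] {s : Set G} (hneg : ∀ m ∈ s, -m ∈ s)
    (hadd : ∀ m ∈ s, ∀ n ∈ s, m - n ∈ s → m + n ∈ s) {m n : G} (hn : n ∈ s) (hm : m ∈ s)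
    (hmn : m + n ∈ s) (k : ℤ) : m + k • n ∈ s := by
  suffices h : m + k • n ∈ s ∧ m + (k + 1) • n ∈ s from h.1
  induction k using Int.induction_on with
  | zero => simpa only [zero_smul, add_zero, zero_add, one_smul] using ⟨hm, hmn⟩
  | succ k ih =>
    refine ⟨ih.2, ?_⟩
    convert hadd _ ih.2 n hn (by convert ih.1 using 1; module) using 1
    module
  | pred k ih =>
    refine ⟨?_, by convert ih.1 using 1; module⟩
    convert hadd _ ih.1 (-n) (hneg n hn) (by convert ih.2 using 1; module) using 1
    module

theorem mem_of_generators {s : Set (ℤ × ℤ)} (hzero : 0 ∈ s) (hneg : ∀ m ∈ s, -m ∈ s)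
    (hadd : ∀ m ∈ s, ∀ n ∈ s, m - n ∈ s → m + n ∈ s) (h₁₀ : (1, 0) ∈ s) (h₀₁ : (0, 1) ∈ s)
    (h₁₁ : (1, 1) ∈ s) (m : ℤ × ℤ) : m ∈ s := by
  have row_zero (k : ℤ) : (k, 0) ∈ s := by
    simpa using add_zsmul_mem hneg hadd h₁₀ hzero (by simpa using h₁₀) k
  have row_one (k : ℤ) : (k, 1) ∈ s := by
    simpa using add_zsmul_mem hneg hadd h₁₀ h₀₁ (by simpa using h₁₁) k
  simpa using add_zsmul_mem hneg hadd h₀₁ (row_zero m.1) (by simpa using row_one m.1) m.2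

end Lattice

section Polar

variable {C D : Type*} [NormedAddCommGroup C] [InnerProductSpace ℂ C]
  [NormedAddCommGroup D] [InnerProductSpace ℂ D] [CompleteSpace D]

theorem denseRange_of_forall_inner_eq_zero {A : C →L[ℂ] D}
    (h : ∀ y, (∀ x, ⟪A x, y⟫_ℂ = 0) → y = 0) : DenseRange A := by
  have hdense : Dense (LinearMap.range A.toLinearMap : Set D) := by
    rw [Submodule.dense_iff_topologicalClosure_eq_top, Submodule.topologicalClosure_eq_top_iff,
      Submodule.eq_bot_iff]
    exact fun y hy => h y fun x =>
      Submodule.inner_right_of_mem_orthogonal (LinearMap.mem_range_self A.toLinearMap x) hy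
  exact hdense

variable [CompleteSpace C]

/-- The modulus `|A| = (A* A)^{1/2}` of a bounded operator between two Hilbert spaces; `CFC.abs`
covers the case of a single space. -/
def modulus (A : C →L[ℂ] D) : C →L[ℂ] C :=
  CFC.sqrt (A.adjoint ∘L A)

theorem inner_modulus_left (A : C →L[ℂ] D) (x y : C) : ⟪modulus A x, y⟫_ℂ = ⟪x, modulus A y⟫_ℂ :=
  ((ContinuousLinearMap.nonneg_iff_isPositive _).1 (CFC.sqrt_nonneg (A.adjoint ∘L A))).isSymmetric
    x y

theorem norm_modulus_apply (A : C →L[ℂ] D) (x : C) : ‖modulus A x‖ = ‖A x‖ := by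
  have hpos : 0 ≤ A.adjoint ∘L A := (ContinuousLinearMap.nonneg_iff_isPositive _).2
    (ContinuousLinearMap.isPositive_adjoint_comp_self A)
  have hsq : modulus A (modulus A x) = A.adjoint (A x) :=
    DFunLike.congr_fun (CFC.sqrt_mul_sqrt_self _ hpos) x
  rw [norm_eq_sqrt_re_inner (𝕜 := ℂ), norm_eq_sqrt_re_inner (𝕜 := ℂ), inner_modulus_left, hsq,
    ContinuousLinearMap.adjoint_inner_right]

theorem denseRange_modulus {A : C →L[ℂ] D} (hA : Function.Injective A) :
    DenseRange (modulus A) := by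
  refine denseRange_of_forall_inner_eq_zero fun y hy => hA ?_
  have hy0 : modulus A y = 0 := ext_inner_left ℂ fun x => by
    rw [← inner_modulus_left, hy, inner_zero_right]
  rw [map_zero, ← norm_eq_zero, ← norm_modulus_apply, hy0, norm_zero]

theorem commute_modulus {A : C →L[ℂ] D} {B : C →L[ℂ] C} (h : Commute (A.adjoint ∘L A) B) :
    Commute (modulus A) B := by
  rw [modulus, CFC.sqrt_eq_cfc]
  exact h.cfc_nnreal _

end Polar

section Flip

variable {L : Type*} [NormedAddCommGroup L] [InnerProductSpace ℂ L] {S : L ≃ₗᵢ[ℂ] L}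
  {N : Submodule ℂ L} {c : ℂ} {x y : L}

/-- The vectors of `N` on which the symmetry `S` acts as the scalar `c`. -/
def flipPart (S : L ≃ₗᵢ[ℂ] L) (N : Submodule ℂ L) (c : ℂ) : Submodule ℂ L :=
  N ⊓ Module.End.eigenspace (S.toLinearEquiv : L →ₗ[ℂ] L) c

theorem mem_flipPart : x ∈ flipPart S N c ↔ x ∈ N ∧ S x = c • x :=
  and_congr_right fun _ => Module.End.mem_eigenspace_iff

theorem isClosed_flipPart (hN : IsClosed (N : Set L)) : IsClosed (flipPart S N c : Set L) := by
  have h : (flipPart S N c : Set L) = (N : Set L) ∩ {x | S x = c • x} :=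
    Set.ext fun _ => mem_flipPart
  exact h ▸ hN.inter (isClosed_eq S.continuous (continuous_const_smul c))

theorem flipPart_one_isOrtho_neg_one : flipPart S N 1 ⟂ flipPart S N (-1) := by
  refine Submodule.isOrtho_iff_inner_eq.2 fun x hx y hy => self_eq_neg.1 ?_
  have hx1 : S x = x := (mem_flipPart.1 hx).2.trans (one_smul ℂ x)
  have hy1 : S y = -y := (mem_flipPart.1 hy).2.trans (neg_one_smul ℂ y)
  rw [← inner_neg_right, ← hy1, ← S.inner_map_map, hx1]

theorem flipPart_one_sup_neg_one (hS : ∀ x, S (S x) = x) (hN : ∀ x ∈ N, S x ∈ N) :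
    flipPart S N 1 ⊔ flipPart S N (-1) = N := by
  refine le_antisymm (sup_le inf_le_left inf_le_left) fun x hx => ?_
  have hsum : x = (1 / 2 : ℂ) • (x + S x) + (1 / 2 : ℂ) • (x - S x) := by module
  rw [hsum]
  refine Submodule.add_mem_sup
    (Submodule.smul_mem _ _ (mem_flipPart.2 ⟨N.add_mem hx (hN x hx), ?_⟩))
    (Submodule.smul_mem _ _ (mem_flipPart.2 ⟨N.sub_mem hx (hN x hx), ?_⟩))
  · rw [map_add, hS, one_smul, add_comm]
  · rw [map_sub, hS, neg_one_smul, neg_sub]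

theorem inner_symmetry_left (hS : ∀ x, S (S x) = x) (x y : L) : ⟪S x, y⟫_ℂ = ⟪x, S y⟫_ℂ := by
  rw [← S.inner_map_map, hS]

variable [CompleteSpace L] {A : L →L[ℂ] L}

theorem adjoint_apply_symmetry (hS : ∀ x, S (S x) = x) (hAS : ∀ x, A (S x) = (-1 : ℂ) • S (A x))
    (x : L) : A.adjoint (S x) = (-1 : ℂ) • S (A.adjoint x) := by
  refine ext_inner_right ℂ fun y => ?_
  rw [ContinuousLinearMap.adjoint_inner_left, inner_symmetry_left hS, neg_one_smul, inner_neg_left,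
    inner_symmetry_left hS, ContinuousLinearMap.adjoint_inner_left, hAS, neg_one_smul,
    inner_neg_right, neg_neg]

theorem apply_mem_flipPart_ker_orthogonal (hA : IsStarNormal A)
    (hAS : ∀ x, A (S x) = (-1 : ℂ) • S (A x)) (hx : S x = c • x) :
    A x ∈ flipPart S A.kerᗮ (-c) := by
  refine mem_flipPart.2 ⟨?_, ?_⟩
  · rw [← ContinuousLinearMap.IsStarNormal.orthogonal_range hA]
    exact Submodule.le_orthogonal_orthogonal _ ⟨x, rfl⟩
  · have h := hAS x
    rwa [hx, map_smul, neg_one_smul, eq_neg_iff_add_eq_zero, add_comm, ← eq_neg_iff_add_eq_zero,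
      ← neg_smul] at h

end Flip

/-- A unitary representation of the additive group `G` on `L`. -/
structure UnitaryRep (G L : Type*) [AddGroup G] [NormedAddCommGroup L] [InnerProductSpace ℂ L] where
  toFun : G → L ≃ₗᵢ[ℂ] L
  map_zero : toFun 0 = 1
  map_add : ∀ z w, toFun (z + w) = toFun z * toFun w

namespace UnitaryRep

section AddGroup

variable {G L : Type*} [AddGroup G] [NormedAddCommGroup L] [InnerProductSpace ℂ L]

instance : CoeFun (UnitaryRep G L) fun _ => G → L ≃ₗᵢ[ℂ] L := ⟨toFun⟩

variable (U : UnitaryRep G L)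

theorem zero_apply (x : L) : U 0 x = x := by
  rw [U.map_zero, LinearIsometryEquiv.coe_one, id_eq]

theorem add_apply (z w : G) (x : L) : U (z + w) x = U z (U w x) := by
  rw [U.map_add, LinearIsometryEquiv.coe_mul, Function.comp_apply]

theorem neg_apply_apply (z : G) (x : L) : U (-z) (U z x) = x := by
  rw [← add_apply, neg_add_cancel, zero_apply]

theorem symm_apply (z : G) (x : L) : (U z).symm x = U (-z) x := by
  rw [LinearIsometryEquiv.symm_apply_eq, ← add_apply, add_neg_cancel, zero_apply]

theorem inner_apply_left (z : G) (x y : L) : ⟪U z x, y⟫_ℂ = ⟪x, U (-z) y⟫_ℂ := by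
  rw [← (U (-z)).inner_map_map, neg_apply_apply]

/-- The operator `U^z` as an element of the C⋆-algebra of bounded operators. -/
def op (z : G) : L →L[ℂ] L := (U z).toLinearIsometry.toContinuousLinearMap

theorem op_apply (z : G) (x : L) : U.op z x = U z x := rfl

theorem norm_op_le (z : G) : ‖U.op z‖ ≤ 1 :=
  (U z).toLinearIsometry.norm_toContinuousLinearMap_le

theorem op_add (z w : G) : U.op (z + w) = U.op z * U.op w := by
  ext x
  exact U.add_apply z w x

theorem star_op [CompleteSpace L] (z : G) : star (U.op z) = U.op (-z) := by
  refine ContinuousLinearMap.ext fun x => ext_inner_right ℂ fun y => ?_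
  rw [ContinuousLinearMap.star_eq_adjoint, ContinuousLinearMap.adjoint_inner_left, op_apply,
    op_apply, inner_apply_left, neg_neg]

/-- `C` is mapped into itself by every operator `U^z`, so that it carries a subrepresentation when
it is closed. -/
def IsInvariant (C : Submodule ℂ L) : Prop :=
  ∀ z, ∀ x ∈ C, U z x ∈ C

variable {U} {C D : Submodule ℂ L}

theorem IsInvariant.symm_mem (hC : U.IsInvariant C) (z : G) {x : L} (hx : x ∈ C) :
    (U z).symm x ∈ C :=
  U.symm_apply z x ▸ hC (-z) x hx

theorem IsInvariant.orthogonal (hC : U.IsInvariant C) : U.IsInvariant Cᗮ := fun z x hx y hy => by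
  rw [← inner_conj_symm, inner_apply_left, inner_conj_symm]
  exact hx _ (hC _ y hy)

theorem IsInvariant.starProjection_apply [C.HasOrthogonalProjection] (hC : U.IsInvariant C)
    (z : G) (x : L) : C.starProjection (U z x) = U z (C.starProjection x) :=
  starProjection_apply_comm (B := U z) (B' := U (-z))
    (fun x y => by rw [inner_apply_left, neg_neg]) (hC z) (hC (-z)) x

/-- The representation on an invariant subspace. -/
def restrict (hC : U.IsInvariant C) : UnitaryRep G C where
  toFun z :=
    { toFun x := ⟨U z x, hC z x x.2⟩
      invFun x := ⟨(U z).symm x, hC.symm_mem z x.2⟩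
      map_add' _ _ := Subtype.ext ((U z).map_add _ _)
      map_smul' c _ := Subtype.ext ((U z).map_smul c _)
      left_inv _ := Subtype.ext ((U z).symm_apply_apply _)
      right_inv _ := Subtype.ext ((U z).apply_symm_apply _)
      norm_map' x := (U z).norm_map x }
  map_zero := by
    ext x
    exact U.zero_apply x
  map_add z w := by
    ext x
    exact U.add_apply z w x

variable (U) in
/-- The closed linear span of the orbit of `x`. -/
def cyclic (x : L) : Submodule ℂ L :=
  (Submodule.span ℂ (Set.range fun z => U z x)).topologicalClosure

variable (U) in
theorem isClosed_cyclic (x : L) : IsClosed (U.cyclic x : Set L) :=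
  Submodule.isClosed_topologicalClosure _

instance [CompleteSpace L] (x : L) : CompleteSpace (U.cyclic x) :=
  (U.isClosed_cyclic x).completeSpace_coe

theorem cyclic_le {x : L} (hCc : IsClosed (C : Set L)) (hC : U.IsInvariant C) (hx : x ∈ C) :
    U.cyclic x ≤ C :=
  closure_span_le hCc (Set.range_subset_iff.2 fun z => hC z x hx)

variable (U) in
theorem apply_mem_cyclic (z : G) (x : L) : U z x ∈ U.cyclic x :=
  subset_closure_span _ (Set.mem_range_self z)

variable (U) in
theorem self_mem_cyclic (x : L) : x ∈ U.cyclic x := by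
  simpa only [zero_apply] using U.apply_mem_cyclic 0 x

variable (U) in
theorem isInvariant_cyclic (x : L) : U.IsInvariant (U.cyclic x) := fun z _ hy =>
  map_mem_of_mem_closure_span (U.op z) (U.isClosed_cyclic x)
    (by
      rintro _ ⟨w, rfl⟩
      rw [op_apply, ← add_apply]
      exact U.apply_mem_cyclic (z + w) x) hy

theorem isInvariant_span_singleton {x : L} (hx : ∀ z, U z x = x) : U.IsInvariant (ℂ ∙ x) := by
  rintro z _ hy
  obtain ⟨c, rfl⟩ := Submodule.mem_span_singleton.1 hy
  rw [_root_.map_smul, hx]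
  exact hy

variable (U) in
/-- Some weak limit of the operators `U^p` is given on `H` by `a + b U^m` with `a`, `b` positive and
`a + b < 1`. -/
def HasLimitOn (H : Submodule ℂ L) (m : G) : Prop :=
  ∃ a b : ℝ, 0 < a ∧ 0 < b ∧ a + b < 1 ∧ ∃ p : ℕ → G, ∀ f ∈ H,
    WeakTendsto ℂ (fun i => U (p i) f) atTop ((a : ℂ) • f + (b : ℂ) • U m f)

variable {M : Type*} [NormedAddCommGroup M] [InnerProductSpace ℂ M]

theorem map_cyclic {V : UnitaryRep G M} {A : L ≃ₗᵢ[ℂ] M} (hA : ∀ z x, A (U z x) = V z (A x))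
    {x : L} (hx : U.cyclic x = ⊤) : V.cyclic (A x) = ⊤ := by
  refine top_le_iff.1 fun y _ => ?_
  have h : A.symm y ∈ U.cyclic x := hx ▸ Submodule.mem_top
  rw [← A.apply_symm_apply y]
  refine map_mem_of_mem_closure_span A.toLinearIsometry.toContinuousLinearMap
    (V.isClosed_cyclic (A x)) ?_ h
  rintro _ ⟨z, rfl⟩
  exact (hA z x).symm ▸ V.apply_mem_cyclic z (A x)

theorem exists_isometryEquiv_of_intertwiner [CompleteSpace L] [CompleteSpace M]
    {V : UnitaryRep G M} {A : L →L[ℂ] M} (hA : ∀ z x, A (U z x) = V z (A x))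
    (hinj : Function.Injective A) (hdense : DenseRange A) :
    ∃ W : L ≃ₗᵢ[ℂ] M, ∀ z x, W (U z x) = V z (W x) := by
  have hcomm (z : G) : Commute (A.adjoint ∘L A) (U.op z) := by
    refine ContinuousLinearMap.ext fun x => ext_inner_right ℂ fun y => ?_
    change ⟪A.adjoint (A (U z x)), y⟫_ℂ = ⟪U z (A.adjoint (A x)), y⟫_ℂ
    rw [ContinuousLinearMap.adjoint_inner_left, hA, inner_apply_left, inner_apply_left, ← hA,
      ContinuousLinearMap.adjoint_inner_left]
  have hmod (z : G) (x : L) : modulus A (U z x) = U z (modulus A x) :=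
    DFunLike.congr_fun (commute_modulus (hcomm z)).eq x
  let W : L ≃ₗᵢ[ℂ] M := LinearEquiv.extendOfIsometry (LinearEquiv.refl ℂ L)
    (modulus A).toLinearMap A.toLinearMap (denseRange_modulus hinj) hdense
    fun x => (norm_modulus_apply A x).symm
  have hW (x : L) : W (modulus A x) = A x := LinearEquiv.extendOfIsometry_eq ..
  refine ⟨W, fun z x => (denseRange_modulus hinj).induction_on
    (p := fun x => W (U z x) = V z (W x)) x ?_ fun y => ?_⟩
  · exact isClosed_eq (W.continuous.comp (U z).continuous) ((V z).continuous.comp W.continuous)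
  · rw [← hmod, hW, hW, hA]

end AddGroup

section Subrepresentations

variable {L : Type*} [NormedAddCommGroup L] [InnerProductSpace ℂ L] (U : UnitaryRep (ℤ × ℤ) L)
  {C D : Submodule ℂ L}

/-- The representation as a family of linear isometries, the form in which `IsCyclicSubspace` and
`RestrictionsIsomorphic` take it. -/
def isometries : ℤ × ℤ → L →ₗᵢ[ℂ] L := fun z => (U z).toLinearIsometry

variable {U}

theorem map_subtype_cyclic_restrict (hCc : IsClosed (C : Set L)) (hC : U.IsInvariant C) (x : C) :
    ((restrict hC).cyclic x).map C.subtype = U.cyclic (x : L) := by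
  refine le_antisymm (Submodule.map_le_iff_le_comap.2 fun y hy => ?_) ?_
  · refine map_mem_of_mem_closure_span C.subtypeL (U.isClosed_cyclic x) ?_ hy
    rintro _ ⟨z, rfl⟩
    exact U.apply_mem_cyclic z x
  · refine closure_span_le (hCc.isClosedEmbedding_subtypeVal.isClosedMap _
      ((restrict hC).isClosed_cyclic x)) ?_
    rintro _ ⟨z, rfl⟩
    exact ⟨_, (restrict hC).apply_mem_cyclic z x, rfl⟩

theorem isCyclicSubspace_iff (hCc : IsClosed (C : Set L)) (hC : U.IsInvariant C) :
    IsCyclicSubspace U.isometries C ↔ ∃ x : C, (restrict hC).cyclic x = ⊤ := by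
  constructor
  · rintro ⟨x, hx : U.cyclic x = C⟩
    refine ⟨⟨x, hx ▸ U.self_mem_cyclic x⟩, ?_⟩
    refine Submodule.map_injective_of_injective C.injective_subtype ?_
    rw [map_subtype_cyclic_restrict hCc, Submodule.map_subtype_top, hx]
  · rintro ⟨x, hx⟩
    have h := map_subtype_cyclic_restrict hCc hC x
    rw [hx, Submodule.map_subtype_top] at h
    exact ⟨x, h.symm⟩

theorem restrictionsIsomorphic_of_isometryEquiv {hC : U.IsInvariant C} {hD : U.IsInvariant D}
    (W : C ≃ₗᵢ[ℂ] D) (hW : ∀ z x, W (restrict hC z x) = restrict hD z (W x)) :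
    RestrictionsIsomorphic U.isometries C D :=
  ⟨hC, W, fun z x => congrArg Subtype.val (hW z x)⟩

theorem symm_intertwines {M : Type*} [NormedAddCommGroup M] [InnerProductSpace ℂ M]
    {V : UnitaryRep (ℤ × ℤ) M} {W : L ≃ₗᵢ[ℂ] M} (hW : ∀ z x, W (U z x) = V z (W x))
    (z : ℤ × ℤ) (y : M) : W.symm (V z y) = U z (W.symm y) := by
  rw [W.symm_apply_eq, hW, W.apply_symm_apply]

theorem exists_fin_two_decomposition (hCc : IsClosed (C : Set L)) (hDc : IsClosed (D : Set L))
    {hC : U.IsInvariant C} {hD : U.IsInvariant D} (hCD : C ⟂ D)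
    (hcyc : IsCyclicSubspace U.isometries C) {W : C ≃ₗᵢ[ℂ] D}
    (hW : ∀ z x, W (restrict hC z x) = restrict hD z (W x)) :
    ∃ C' : Fin 2 → Submodule ℂ L, (∀ i, IsCyclicSubspace U.isometries (C' i)) ∧
      (Pairwise fun i j => C' i ⟂ C' j) ∧ (⨆ i, C' i) = C ⊔ D ∧
      ∀ i j, RestrictionsIsomorphic U.isometries (C' i) (C' j) := by
  have hcyc' : IsCyclicSubspace U.isometries D := by
    obtain ⟨x, hx⟩ := (isCyclicSubspace_iff hCc hC).1 hcyc
    exact (isCyclicSubspace_iff hDc hD).2 ⟨W x, map_cyclic hW hx⟩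
  have hrefl {C : Submodule ℂ L} (hC : U.IsInvariant C) : RestrictionsIsomorphic U.isometries C C :=
    restrictionsIsomorphic_of_isometryEquiv (hC := hC) (hD := hC) (.refl ℂ C) fun _ _ => rfl
  refine ⟨![C, D], Fin.forall_fin_two.2 ⟨hcyc, hcyc'⟩, ?_, le_antisymm
    (iSup_le (Fin.forall_fin_two.2 ⟨le_sup_left, le_sup_right⟩))
    (sup_le (le_iSup ![C, D] 0) (le_iSup ![C, D] 1)), ?_⟩
  · intro i j hij
    fin_cases i <;> fin_cases j <;> first | exact absurd rfl hij | exact hCD | exact hCD.symm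
  · exact Fin.forall_fin_two.2 ⟨Fin.forall_fin_two.2 ⟨hrefl hC,
      restrictionsIsomorphic_of_isometryEquiv W hW⟩, Fin.forall_fin_two.2
        ⟨restrictionsIsomorphic_of_isometryEquiv W.symm (symm_intertwines hW), hrefl hD⟩⟩

theorem IsInvariant.flipPart {S : L ≃ₗᵢ[ℂ] L} {N : Submodule ℂ L} (hN : U.IsInvariant N)
    (hSU : ∀ z x, S (U z x) = U z (S x)) (c : ℂ) : U.IsInvariant (flipPart S N c) :=
  fun z x hx => by
    rw [mem_flipPart] at hx ⊢
    exact ⟨hN z x hx.1, by rw [hSU, hx.2, _root_.map_smul]⟩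

variable [CompleteSpace L]

theorem exists_restrict_isometryEquiv (hCc : IsClosed (C : Set L)) (hDc : IsClosed (D : Set L))
    (hC : U.IsInvariant C) (hD : U.IsInvariant D) {A : L →L[ℂ] L}
    (hA : ∀ z x, A (U z x) = U z (A x)) (hCD : ∀ x ∈ C, A x ∈ D)
    (hinj : ∀ x ∈ C, A x = 0 → x = 0) (hdense : ∀ y ∈ D, (∀ x ∈ C, ⟪A x, y⟫_ℂ = 0) → y = 0) :
    ∃ W : C ≃ₗᵢ[ℂ] D, ∀ z x, W (restrict hC z x) = restrict hD z (W x) := by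
  have : CompleteSpace C := hCc.completeSpace_coe
  have : CompleteSpace D := hDc.completeSpace_coe
  let A' : C →L[ℂ] D := (A ∘L C.subtypeL).codRestrict D fun x => hCD x x.2
  refine exists_isometryEquiv_of_intertwiner (A := A') (fun z x => Subtype.ext (hA z x)) ?_ ?_
  · refine (injective_iff_map_eq_zero A').2 fun x hx => Subtype.ext (hinj x x.2 ?_)
    exact congrArg Subtype.val hx
  · exact denseRange_of_forall_inner_eq_zero fun y hy =>
      Subtype.ext (hdense y y.2 fun x hx => hy ⟨x, hx⟩)

theorem exists_fin_two_decomposition_of_flip {S : L ≃ₗᵢ[ℂ] L} (hS : ∀ x, S (S x) = x)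
    (hSU : ∀ z x, S (U z x) = U z (S x)) {A : L →L[ℂ] L} (hA : IsStarNormal A)
    (hAU : ∀ z x, A (U z x) = U z (A x)) (hAS : ∀ x, A (S x) = (-1 : ℂ) • S (A x))
    (hcyc : IsCyclicSubspace U.isometries (flipPart S A.kerᗮ 1)) :
    ∃ C' : Fin 2 → Submodule ℂ L, (∀ i, IsCyclicSubspace U.isometries (C' i)) ∧
      (Pairwise fun i j => C' i ⟂ C' j) ∧ (⨆ i, C' i) = A.kerᗮ ∧
      ∀ i j, RestrictionsIsomorphic U.isometries (C' i) (C' j) := by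
  have hcl (c : ℂ) : IsClosed (flipPart S A.kerᗮ c : Set L) :=
    isClosed_flipPart (Submodule.isClosed_orthogonal _)
  have hinv : U.IsInvariant A.kerᗮ := IsInvariant.orthogonal fun z x (hx : A x = 0) => by
    change A (U z x) = 0
    rw [hAU, hx, _root_.map_zero]
  have hSN (x : L) (hx : x ∈ A.kerᗮ) : S x ∈ A.kerᗮ := fun y (hy : A y = 0) => by
    rw [← inner_symmetry_left hS]
    refine hx _ (?_ : A (S y) = 0)
    rw [hAS, hy, _root_.map_zero, smul_zero]
  have ker_inter {x : L} (hx : x ∈ A.kerᗮ) (h : A x = 0) : x = 0 :=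
    Submodule.disjoint_def.1 A.ker.orthogonal_disjoint x h hx
  have hdense (y : L) (hy : y ∈ flipPart S A.kerᗮ (-1))
      (h : ∀ x ∈ flipPart S A.kerᗮ 1, ⟪A x, y⟫_ℂ = 0) : y = 0 := by
    have hadj : A.adjoint y ∈ flipPart S A.kerᗮ 1 := by
      simpa only [ContinuousLinearMap.IsStarNormal.ker_adjoint_eq_ker hA, neg_neg] using
        apply_mem_flipPart_ker_orthogonal (A := A.adjoint) hA.star (adjoint_apply_symmetry hS hAS)
          (mem_flipPart.1 hy).2
    have h0 := h _ hadj
    rw [← ContinuousLinearMap.adjoint_inner_right, inner_self_eq_zero] at h0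
    exact ker_inter (mem_flipPart.1 hy).1
      ((ContinuousLinearMap.IsStarNormal.adjoint_apply_eq_zero_iff hA y).1 h0)
  obtain ⟨W, hW⟩ := exists_restrict_isometryEquiv (hcl 1) (hcl (-1)) (hinv.flipPart hSU 1)
    (hinv.flipPart hSU (-1)) hAU
    (fun x hx => apply_mem_flipPart_ker_orthogonal hA hAS (mem_flipPart.1 hx).2)
    (fun x hx => ker_inter (mem_flipPart.1 hx).1) hdense
  rw [← flipPart_one_sup_neg_one hS hSN]
  exact exists_fin_two_decomposition (hcl 1) (hcl (-1)) flipPart_one_isOrtho_neg_one hcyc hW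

end Subrepresentations

section AddCommGroup

variable {G K : Type*} [AddCommGroup G] [NormedAddCommGroup K] [InnerProductSpace ℂ K]

theorem commute_op (U : UnitaryRep G K) (z w : G) : Commute (U.op z) (U.op w) := by
  rw [commute_iff_eq, ← op_add, ← op_add, add_comm]

variable (V : UnitaryRep (G × G) K)

/-- The restriction of a representation of `G × G` to the diagonal subgroup. -/
def diag : UnitaryRep G K where
  toFun z := V (z, z)
  map_zero := V.map_zero
  map_add z w := V.map_add (z, z) (w, w)

/-- For a tensor product of representations, `symSum m` is `U^m ⊗ 1 + 1 ⊗ U^m`. -/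
def symSum (m : G) : K →L[ℂ] K := V.op (m, 0) + V.op (0, m)

/-- For a tensor product of representations, `antiSum m` is `U^m ⊗ 1 - 1 ⊗ U^m`. -/
def antiSum (m : G) : K →L[ℂ] K := V.op (m, 0) - V.op (0, m)

theorem diag_apply (z : G) (x : K) : V.diag z x = V (z, z) x := rfl

theorem symSum_apply (m : G) (x : K) : V.symSum m x = V (m, 0) x + V (0, m) x := rfl

theorem antiSum_apply (m : G) (x : K) : V.antiSum m x = V (m, 0) x - V (0, m) x := rfl

theorem symSum_neg (m : G) (x : K) : V.symSum (-m) x = V.diag (-m) (V.symSum m x) := by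
  simp only [symSum_apply, diag_apply, _root_.map_add, ← add_apply, Prod.mk_add_mk, add_zero,
    neg_add_cancel]
  exact add_comm _ _

theorem symSum_add (m n : G) (x : K) :
    V.symSum (m + n) x = V.symSum m (V.symSum n x) - V.diag n (V.symSum (m - n) x) := by
  simp only [symSum_apply, diag_apply, _root_.map_add, ← add_apply, Prod.mk_add_mk, add_zero,
    zero_add, add_sub_cancel]
  abel

theorem commute_antiSum (m n : G) : Commute (V.antiSum m) (V.antiSum n) :=
  .sub_left (.sub_right (V.commute_op _ _) (V.commute_op _ _))
    (.sub_right (V.commute_op _ _) (V.commute_op _ _))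

theorem antiSum_diag_apply (m z : G) (x : K) :
    V.antiSum m (V.diag z x) = V.diag z (V.antiSum m x) :=
  DFunLike.congr_fun (Commute.sub_left (V.commute_op (m, 0) (z, z)) (V.commute_op (0, m) _)).eq x

theorem antiSum_apply_of_swap {S : K ≃ₗᵢ[ℂ] K} (hS : ∀ z w x, S (V (z, w) x) = V (w, z) (S x))
    (m : G) (x : K) : V.antiSum m (S x) = (-1 : ℂ) • S (V.antiSum m x) := by
  rw [antiSum_apply, antiSum_apply, map_sub, hS, hS, neg_one_smul, neg_sub]

variable [CompleteSpace K]

theorem star_antiSum (m : G) : star (V.antiSum m) = V.antiSum (-m) := by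
  rw [antiSum, star_sub, star_op, star_op, Prod.neg_mk, Prod.neg_mk, neg_zero, antiSum]

theorem isStarNormal_antiSum (m : G) : IsStarNormal (V.antiSum m) :=
  ⟨V.star_antiSum m ▸ V.commute_antiSum (-m) m⟩

end AddCommGroup

end UnitaryRep

/-- A realization of the Hilbert space tensor product of `L` and `M` on the space `K`: an isometric
embedding of the algebraic tensor product with dense range. -/
structure HilbertTensor (L M K : Type*) [NormedAddCommGroup L] [InnerProductSpace ℂ L]
    [NormedAddCommGroup M] [InnerProductSpace ℂ M] [NormedAddCommGroup K]
    [InnerProductSpace ℂ K] where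
  embedding : L ⊗[ℂ] M →ₗᵢ[ℂ] K
  denseRange : DenseRange embedding

namespace HilbertTensor

variable {L M K : Type*} [NormedAddCommGroup L] [InnerProductSpace ℂ L] [NormedAddCommGroup M]
  [InnerProductSpace ℂ M] [NormedAddCommGroup K] [InnerProductSpace ℂ K]

section OfBilinear

variable {B : L →ₗ[ℂ] M →ₗ[ℂ] K}

theorem inner_lift_apply (hinner : ∀ f f' g g', ⟪B f g, B f' g'⟫_ℂ = ⟪f, f'⟫_ℂ * ⟪g, g'⟫_ℂ)
    (x y : L ⊗[ℂ] M) : ⟪TensorProduct.lift B x, TensorProduct.lift B y⟫_ℂ = ⟪x, y⟫_ℂ := by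
  induction x with
  | zero => rw [map_zero, inner_zero_left, inner_zero_left]
  | add x x' hx hx' => rw [map_add, inner_add_left, inner_add_left, hx, hx']
  | tmul f g =>
    induction y with
    | zero => rw [map_zero, inner_zero_right, inner_zero_right]
    | add y y' hy hy' => rw [map_add, inner_add_right, inner_add_right, hy, hy']
    | tmul f' g' =>
      rw [TensorProduct.lift.tmul, TensorProduct.lift.tmul, hinner, TensorProduct.inner_tmul]

/-- The realization of the Hilbert space tensor product given by a bilinear map `B` that multiplies
inner products and whose values have no nonzero common orthogonal vector. -/
def ofBilinear [CompleteSpace K]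
    (hinner : ∀ f f' g g', ⟪B f g, B f' g'⟫_ℂ = ⟪f, f'⟫_ℂ * ⟪g, g'⟫_ℂ)
    (htotal : ∀ y, (∀ f g, ⟪B f g, y⟫_ℂ = 0) → y = 0) : HilbertTensor L M K where
  embedding := (TensorProduct.lift B).isometryOfInner (inner_lift_apply hinner)
  denseRange := denseRange_of_forall_inner_eq_zero
    (A := ((TensorProduct.lift B).isometryOfInner
      (inner_lift_apply hinner)).toContinuousLinearMap)
    fun y hy => htotal y fun f g => TensorProduct.lift.tmul (f' := B) f g ▸ hy (f ⊗ₜ g)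

end OfBilinear

section Basic

variable (t : HilbertTensor L M K)

/-- The bounded bilinear map sending `f` and `g` to the vector of `K` which represents `f ⊗ g`. -/
def tens : L →L[ℂ] M →L[ℂ] K :=
  LinearMap.mkContinuous₂ ((TensorProduct.mk ℂ L M).compr₂ t.embedding.toLinearMap) 1 fun f g => by
    simp

theorem tens_apply (f : L) (g : M) : t.tens f g = t.embedding (f ⊗ₜ[ℂ] g) := rfl

theorem ofBilinear_tens [CompleteSpace K] {B : L →ₗ[ℂ] M →ₗ[ℂ] K}
    (hinner : ∀ f f' g g', ⟪B f g, B f' g'⟫_ℂ = ⟪f, f'⟫_ℂ * ⟪g, g'⟫_ℂ)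
    (htotal : ∀ y, (∀ f g, ⟪B f g, y⟫_ℂ = 0) → y = 0) (f : L) (g : M) :
    (ofBilinear hinner htotal).tens f g = B f g :=
  TensorProduct.lift.tmul f g

theorem inner_tens (f f' : L) (g g' : M) :
    ⟪t.tens f g, t.tens f' g'⟫_ℂ = ⟪f, f'⟫_ℂ * ⟪g, g'⟫_ℂ := by
  rw [tens_apply, tens_apply, LinearIsometry.inner_map_map, TensorProduct.inner_tmul]

/-- The closed span of the tensors `f ⊗ g` with `f ∈ P` and `g ∈ Q`. -/
def prod (P : Submodule ℂ L) (Q : Submodule ℂ M) : Submodule ℂ K :=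
  (Submodule.span ℂ (Set.image2 (fun f g => t.tens f g) P Q)).topologicalClosure

theorem isClosed_prod (P : Submodule ℂ L) (Q : Submodule ℂ M) : IsClosed (t.prod P Q : Set K) :=
  Submodule.isClosed_topologicalClosure _

instance [CompleteSpace K] (P : Submodule ℂ L) (Q : Submodule ℂ M) : CompleteSpace (t.prod P Q) :=
  (t.isClosed_prod P Q).completeSpace_coe

variable {P P' : Submodule ℂ L} {Q Q' : Submodule ℂ M}

theorem tens_mem_prod {f : L} {g : M} (hf : f ∈ P) (hg : g ∈ Q) : t.tens f g ∈ t.prod P Q :=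
  subset_closure_span _ ⟨f, hf, g, hg, rfl⟩

theorem map_mem_of_mem_prod {K' : Type*} [NormedAddCommGroup K'] [InnerProductSpace ℂ K']
    (A : K →L[ℂ] K') {C : Submodule ℂ K'} (hC : IsClosed (C : Set K'))
    (h : ∀ f ∈ P, ∀ g ∈ Q, A (t.tens f g) ∈ C) {x : K} (hx : x ∈ t.prod P Q) : A x ∈ C :=
  map_mem_of_mem_closure_span A hC (by rintro _ ⟨f, hf, g, hg, rfl⟩; exact h f hf g hg) hx

theorem map_mem_of_mem_prod_closure_span {K' : Type*} [NormedAddCommGroup K']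
    [InnerProductSpace ℂ K'] {s : Set L} {s' : Set M} (A : K →L[ℂ] K') {C : Submodule ℂ K'}
    (hC : IsClosed (C : Set K')) (h : ∀ f ∈ s, ∀ g ∈ s', A (t.tens f g) ∈ C) {x : K}
    (hx : x ∈ t.prod (Submodule.span ℂ s).topologicalClosure
      (Submodule.span ℂ s').topologicalClosure) : A x ∈ C :=
  t.map_mem_of_mem_prod A hC (fun _ hf _ hg =>
    map_mem_of_mem_closure_span (A ∘L t.tens.flip _) hC (fun f hf =>
      map_mem_of_mem_closure_span (A ∘L t.tens f) hC (h f hf) hg) hf) hx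

theorem prod_le {C : Submodule ℂ K} (hC : IsClosed (C : Set K))
    (h : ∀ f ∈ P, ∀ g ∈ Q, t.tens f g ∈ C) : t.prod P Q ≤ C := fun _ =>
  t.map_mem_of_mem_prod (.id ℂ K) hC h

theorem prod_span_singleton [CompleteSpace K] (f : L) (g : M) :
    t.prod (ℂ ∙ f) (ℂ ∙ g) = ℂ ∙ t.tens f g := by
  refine le_antisymm (t.prod_le (Submodule.closed_of_finiteDimensional _) fun f' hf g' hg => ?_)
    ((Submodule.span_singleton_le_iff_mem _ _).2 <| t.tens_mem_prod
      (Submodule.mem_span_singleton_self f) (Submodule.mem_span_singleton_self g))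
  obtain ⟨c, rfl⟩ := Submodule.mem_span_singleton.1 hf
  obtain ⟨d, rfl⟩ := Submodule.mem_span_singleton.1 hg
  rw [map_smul, map_smul, smul_apply, smul_smul]
  exact Submodule.smul_mem _ _ (Submodule.mem_span_singleton_self _)

theorem prod_mono (hP : P ≤ P') (hQ : Q ≤ Q') : t.prod P Q ≤ t.prod P' Q' :=
  t.prod_le (t.isClosed_prod P' Q') fun _ hf _ hg => t.tens_mem_prod (hP hf) (hQ hg)

theorem prod_isOrtho (h : P ⟂ P' ∨ Q ⟂ Q') : t.prod P Q ⟂ t.prod P' Q' := by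
  refine t.prod_le (Submodule.isClosed_orthogonal _) fun f hf g hg => ?_
  rw [← Submodule.span_singleton_le_iff_mem, ← Submodule.isOrtho_iff_le, Submodule.isOrtho_comm]
  refine t.prod_le (Submodule.isClosed_orthogonal _) fun f' hf' g' hg' => ?_
  rw [Submodule.mem_orthogonal_singleton_iff_inner_right, inner_tens, mul_eq_zero]
  exact h.imp (fun h => Submodule.isOrtho_iff_inner_eq.1 h f hf f' hf')
    fun h => Submodule.isOrtho_iff_inner_eq.1 h g hg g' hg'

theorem prod_top_top : t.prod ⊤ ⊤ = ⊤ := by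
  have hrange : Set.range t.embedding ⊆ t.prod ⊤ ⊤ := by
    rintro _ ⟨x, rfl⟩
    induction x with
    | zero => rw [map_zero]; exact Submodule.zero_mem _
    | tmul f g => exact t.tens_mem_prod Submodule.mem_top Submodule.mem_top
    | add x y hx hy => rw [map_add]; exact Submodule.add_mem _ hx hy
  refine top_le_iff.1 fun x _ => ?_
  exact closure_minimal hrange (t.isClosed_prod ⊤ ⊤) (t.denseRange x)

theorem ext_tens {K' : Type*} [NormedAddCommGroup K'] [InnerProductSpace ℂ K'] {A B : K →L[ℂ] K'}
    (h : ∀ f g, A (t.tens f g) = B (t.tens f g)) : A = B := by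
  ext x
  have hx : (A - B) x ∈ (⊥ : Submodule ℂ K') :=
    t.map_mem_of_mem_prod (P := ⊤) (Q := ⊤) _ isClosed_singleton
      (fun f _ g _ => sub_eq_zero.2 (h f g)) (t.prod_top_top ▸ Submodule.mem_top)
  exact sub_eq_zero.1 hx

theorem isometryEquiv_ext_tens {A B : K ≃ₗᵢ[ℂ] K} (h : ∀ f g, A (t.tens f g) = B (t.tens f g)) :
    A = B :=
  LinearIsometryEquiv.ext fun x => DFunLike.congr_fun
    (t.ext_tens (A := A.toLinearIsometry.toContinuousLinearMap)
      (B := B.toLinearIsometry.toContinuousLinearMap) h) x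

theorem orthogonal_prod_le [CompleteSpace K] [P.HasOrthogonalProjection]
    [Q.HasOrthogonalProjection] {C : Submodule ℂ K} (hC : IsClosed (C : Set K))
    (hl : t.prod Pᗮ ⊤ ≤ C) (hr : t.prod ⊤ Qᗮ ≤ C) : (t.prod P Q)ᗮ ≤ C := by
  intro x hx
  let D : Submodule ℂ K := (t.prod Pᗮ ⊤ ⊔ t.prod ⊤ Qᗮ).topologicalClosure
  have : CompleteSpace D := (Submodule.isClosed_topologicalClosure _).completeSpace_coe
  have hDC : D ≤ C := Submodule.topologicalClosure_minimal _ (sup_le hl hr) hC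
  have hsup : t.prod Pᗮ ⊤ ⊔ t.prod ⊤ Qᗮ ≤ D := Submodule.le_topologicalClosure _
  have hD : D ≤ (t.prod P Q)ᗮ := Submodule.topologicalClosure_minimal _
    (sup_le (t.prod_isOrtho (.inl P.isOrtho_orthogonal_right.symm))
      (t.prod_isOrtho (.inr Q.isOrtho_orthogonal_right.symm))) (Submodule.isClosed_orthogonal _)
  let r : K := x - D.starProjection x
  have hrD : r ∈ Dᗮ := Submodule.sub_starProjection_mem_orthogonal x
  have hrPQ : r ∈ (t.prod P Q)ᗮ :=
    Submodule.sub_mem _ hx (hD (Submodule.starProjection_apply_mem _ _))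
  have hr0 : innerSL ℂ r = 0 := t.ext_tens fun f g => by
    have hsplit : t.tens f g = t.tens (f - P.starProjection f) g +
        t.tens (P.starProjection f) (g - Q.starProjection g) +
        t.tens (P.starProjection f) (Q.starProjection g) := by
      simp only [map_sub, sub_apply]
      abel
    rw [innerSL_apply_apply, zero_apply, hsplit, inner_add_right,
      inner_add_right,
      Submodule.inner_left_of_mem_orthogonal (hsup (Submodule.mem_sup_left (t.tens_mem_prod
        (Submodule.sub_starProjection_mem_orthogonal f) Submodule.mem_top))) hrD,
      Submodule.inner_left_of_mem_orthogonal (hsup (Submodule.mem_sup_right (t.tens_mem_prod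
        Submodule.mem_top (Submodule.sub_starProjection_mem_orthogonal g)))) hrD,
      Submodule.inner_left_of_mem_orthogonal (t.tens_mem_prod
        (Submodule.starProjection_apply_mem _ f) (Submodule.starProjection_apply_mem _ g)) hrPQ,
      add_zero, add_zero]
  have hr' : r = 0 := inner_self_eq_zero.1 (DFunLike.congr_fun hr0 r)
  exact hDC (sub_eq_zero.1 hr' ▸ Submodule.starProjection_apply_mem _ _)

section Weak

variable {ι : Type*} {l : Filter ι}

theorem weakTendsto_of_tens {x : ι → L} {y : ι → M} {z : K} {A B : ℝ} (hA : ∀ i, ‖x i‖ ≤ A)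
    (hB : ∀ i, ‖y i‖ ≤ B)
    (h : ∀ f g, Tendsto (fun i => ⟪f, x i⟫_ℂ * ⟪g, y i⟫_ℂ) l (𝓝 ⟪t.tens f g, z⟫_ℂ)) :
    WeakTendsto ℂ (fun i => t.tens (x i) (y i)) l z := by
  refine weakTendsto_of_closure_span_eq_top (M := A * B) (fun i => ?_) t.prod_top_top ?_
  · rw [tens_apply, LinearIsometry.norm_map, TensorProduct.norm_tmul]
    exact mul_le_mul (hA i) (hB i) (norm_nonneg _) ((norm_nonneg _).trans (hA i))
  · rintro _ ⟨f, -, g, -, rfl⟩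
    simpa only [inner_tens] using h f g

theorem weakTendsto_tens {x : ι → L} {y : ι → M} {f : L} {g : M} {A B : ℝ}
    (hx : WeakTendsto ℂ x l f) (hy : WeakTendsto ℂ y l g) (hA : ∀ i, ‖x i‖ ≤ A)
    (hB : ∀ i, ‖y i‖ ≤ B) : WeakTendsto ℂ (fun i => t.tens (x i) (y i)) l (t.tens f g) :=
  t.weakTendsto_of_tens hA hB fun f' g' => by
    simpa only [inner_tens] using (hx f').mul (hy g')

theorem weakTendsto_tens_zero {x : ι → L} {y : ι → M} {A B : ℝ} (hy : WeakTendsto ℂ y l 0)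
    (hA : ∀ i, ‖x i‖ ≤ A) (hB : ∀ i, ‖y i‖ ≤ B) :
    WeakTendsto ℂ (fun i => t.tens (x i) (y i)) l 0 :=
  t.weakTendsto_of_tens hA hB fun f' g' => by
    rw [inner_zero_right]
    refine squeeze_zero_norm (a := fun i => ‖f'‖ * A * ‖⟪g', y i⟫_ℂ‖) (fun i => ?_) ?_
    · rw [norm_mul]
      exact mul_le_mul_of_nonneg_right ((norm_inner_le_norm _ _).trans
        (mul_le_mul_of_nonneg_left (hA i) (norm_nonneg _))) (norm_nonneg _)
    · simpa only [inner_zero_right, norm_zero, mul_zero] using (hy g').norm.const_mul (‖f'‖ * A)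

end Weak

end Basic

section Map

variable [CompleteSpace K] (t : HilbertTensor L M K)

/-- The unitary operator `u ⊗ v`. -/
def map (u : L ≃ₗᵢ[ℂ] L) (v : M ≃ₗᵢ[ℂ] M) : K ≃ₗᵢ[ℂ] K :=
  LinearEquiv.extendOfIsometry (TensorProduct.congrIsometry u v).toLinearEquiv
    t.embedding.toLinearMap t.embedding.toLinearMap t.denseRange t.denseRange fun x =>
      (t.embedding.norm_map _).trans
        ((LinearIsometryEquiv.norm_map _ x).trans (t.embedding.norm_map x).symm)

theorem map_tens (u : L ≃ₗᵢ[ℂ] L) (v : M ≃ₗᵢ[ℂ] M) (f : L) (g : M) :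
    t.map u v (t.tens f g) = t.tens (u f) (v g) :=
  LinearEquiv.extendOfIsometry_eq ..

theorem map_one_one : t.map 1 1 = 1 :=
  t.isometryEquiv_ext_tens fun f g => t.map_tens 1 1 f g

theorem map_mul_map (u u' : L ≃ₗᵢ[ℂ] L) (v v' : M ≃ₗᵢ[ℂ] M) :
    t.map u v * t.map u' v' = t.map (u * u') (v * v') :=
  t.isometryEquiv_ext_tens fun f g => by
    simp only [LinearIsometryEquiv.coe_mul, Function.comp_apply, map_tens]

theorem map_map_apply (u u' : L ≃ₗᵢ[ℂ] L) (v v' : M ≃ₗᵢ[ℂ] M) (x : K) :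
    t.map u v (t.map u' v' x) = t.map (u * u') (v * v') x :=
  DFunLike.congr_fun (t.map_mul_map u u' v v') x

theorem map_one_one_apply (x : K) : t.map 1 1 x = x :=
  DFunLike.congr_fun t.map_one_one x

theorem map_mem_prod {P P' : Submodule ℂ L} {Q Q' : Submodule ℂ M} {u : L ≃ₗᵢ[ℂ] L}
    {v : M ≃ₗᵢ[ℂ] M} (hu : ∀ f ∈ P, u f ∈ P') (hv : ∀ g ∈ Q, v g ∈ Q') {x : K}
    (hx : x ∈ t.prod P Q) : t.map u v x ∈ t.prod P' Q' :=
  t.map_mem_of_mem_prod (t.map u v).toLinearIsometry.toContinuousLinearMap (t.isClosed_prod _ _)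
    (fun f hf g hg => t.map_tens u v f g ▸ t.tens_mem_prod (hu f hf) (hv g hg)) hx

/-- The external tensor product of two representations. -/
def outer {G G' : Type*} [AddGroup G] [AddGroup G'] (U : UnitaryRep G L) (V : UnitaryRep G' M) :
    UnitaryRep (G × G') K where
  toFun z := t.map (U z.1) (V z.2)
  map_zero := by rw [Prod.fst_zero, Prod.snd_zero, U.map_zero, V.map_zero, map_one_one]
  map_add z w := by rw [Prod.fst_add, Prod.snd_add, U.map_add, V.map_add, map_mul_map]

theorem outer_tens {G G' : Type*} [AddGroup G] [AddGroup G'] (U : UnitaryRep G L)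
    (V : UnitaryRep G' M) (z : G × G') (f : L) (g : M) :
    t.outer U V z (t.tens f g) = t.tens (U z.1 f) (V z.2 g) :=
  t.map_tens _ _ f g

theorem isInvariant_prod {G G' : Type*} [AddGroup G] [AddGroup G'] {U : UnitaryRep G L}
    {V : UnitaryRep G' M} {P : Submodule ℂ L} {Q : Submodule ℂ M} (hP : U.IsInvariant P)
    (hQ : V.IsInvariant Q) : (t.outer U V).IsInvariant (t.prod P Q) := fun z _ =>
  t.map_mem_prod (hP z.1) (hQ z.2)

end Map

section Swap

variable [CompleteSpace K] (t : HilbertTensor L L K)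

/-- The flip `f ⊗ g ↦ g ⊗ f`. -/
def swap : K ≃ₗᵢ[ℂ] K :=
  LinearEquiv.extendOfIsometry (TensorProduct.commIsometry ℂ L L).toLinearEquiv
    t.embedding.toLinearMap t.embedding.toLinearMap t.denseRange t.denseRange fun x =>
      (t.embedding.norm_map _).trans
        ((LinearIsometryEquiv.norm_map _ x).trans (t.embedding.norm_map x).symm)

theorem swap_tens (f g : L) : t.swap (t.tens f g) = t.tens g f :=
  LinearEquiv.extendOfIsometry_eq ..

theorem swap_swap (x : K) : t.swap (t.swap x) = x := by
  have h : t.swap * t.swap = 1 := t.isometryEquiv_ext_tens fun f g => by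
    simp only [LinearIsometryEquiv.coe_mul, Function.comp_apply, swap_tens,
      LinearIsometryEquiv.coe_one, id_eq]
  exact DFunLike.congr_fun h x

theorem swap_outer_apply {G : Type*} [AddGroup G] (U : UnitaryRep G L) (z w : G) (x : K) :
    t.swap (t.outer U U (z, w) x) = t.outer U U (w, z) (t.swap x) := by
  have h : t.swap * t.outer U U (z, w) = t.outer U U (w, z) * t.swap :=
    t.isometryEquiv_ext_tens fun f g => by
      simp only [LinearIsometryEquiv.coe_mul, Function.comp_apply, swap_tens, outer_tens]
  exact DFunLike.congr_fun h x

theorem swap_mem_prod {P Q : Submodule ℂ L} {x : K} (hx : x ∈ t.prod P Q) :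
    t.swap x ∈ t.prod Q P :=
  t.map_mem_of_mem_prod t.swap.toLinearIsometry.toContinuousLinearMap (t.isClosed_prod _ _)
    (fun f hf g hg => t.swap_tens f g ▸ t.tens_mem_prod hg hf) hx

end Swap

section Fixed

variable [CompleteSpace K] (t : HilbertTensor L M K) {G : Type*} [AddGroup G]
  {U : UnitaryRep G M} {H : Submodule ℂ M} {m : G} {F : K}

theorem map_left_apply_of_forall {u v : L ≃ₗᵢ[ℂ] L} {c c' : ℂ}
    (h : ∀ x, v x - c' • u (v x) = c • x - u x) (x : K) :
    t.map v 1 x - c' • t.map u 1 (t.map v 1 x) = c • x - t.map u 1 x := by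
  let op (w : L ≃ₗᵢ[ℂ] L) : K →L[ℂ] K := (t.map w 1).toLinearIsometry.toContinuousLinearMap
  have hop : op v - c' • op u ∘L op v = c • .id ℂ K - op u := t.ext_tens fun f g => by
    change t.map v 1 (t.tens f g) - c' • t.map u 1 (t.map v 1 (t.tens f g)) =
      c • t.tens f g - t.map u 1 (t.tens f g)
    simp only [map_tens, LinearIsometryEquiv.coe_one, id_eq]
    simpa only [map_sub, map_smul, ContinuousLinearMap.flip_apply] using
      congrArg (t.tens.flip g) (h f)
  exact DFunLike.congr_fun hop x

theorem weakTendsto_map_sub_map {ι : Type*} {l : Filter ι} {v : ι → L ≃ₗᵢ[ℂ] L}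
    {u : ι → M ≃ₗᵢ[ℂ] M} {w : M ≃ₗᵢ[ℂ] M} {a b : ℂ}
    (hu : ∀ g ∈ H, WeakTendsto ℂ (fun i => u i g) l (a • g + b • w g)) (hF : F ∈ t.prod ⊤ H) :
    WeakTendsto ℂ (fun i => t.map (v i) (u i) F - t.map (v i) 1 (a • F + b • t.map 1 w F)) l 0 := by
  let op (v : L ≃ₗᵢ[ℂ] L) (u : M ≃ₗᵢ[ℂ] M) : K →L[ℂ] K :=
    (t.map v u).toLinearIsometry.toContinuousLinearMap
  have norm_op_le (v u) : ‖op v u‖ ≤ 1 := LinearIsometry.norm_toContinuousLinearMap_le _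
  let N : K →L[ℂ] K := a • .id ℂ K + b • op 1 w
  refine weakTendsto_apply_of_mem_closure_span (O := fun i => op (v i) (u i) - op (v i) 1 ∘L N)
    (A := 0) (M := 1 + 1 * ‖N‖) (fun i => (norm_sub_le _ _).trans ?_) ?_ hF
  · exact add_le_add (norm_op_le _ _) ((ContinuousLinearMap.opNorm_comp_le _ _).trans
      (mul_le_mul_of_nonneg_right (norm_op_le _ _) (norm_nonneg _)))
  rintro _ ⟨f, -, g, hg, rfl⟩
  have htens (i) : (op (v i) (u i) - op (v i) 1 ∘L N) (t.tens f g) =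
      t.tens (v i f) (u i g - (a • g + b • w g)) := by
    change t.map (v i) (u i) (t.tens f g) -
      t.map (v i) 1 (a • t.tens f g + b • t.map 1 w (t.tens f g)) = _
    simp only [map_tens, map_add, map_smul, map_sub, LinearIsometryEquiv.coe_one, id_eq]
  have hzero : WeakTendsto ℂ (fun i => u i g - (a • g + b • w g)) l 0 := fun g' => by
    simpa only [inner_sub_right, inner_zero_right, sub_self] using
      (hu g hg g').sub_const ⟪g', a • g + b • w g⟫_ℂ
  simp only [htens]
  exact t.weakTendsto_tens_zero hzero (fun i => ((v i).norm_map f).le)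
    fun i => (norm_sub_le _ _).trans_eq (by rw [LinearIsometryEquiv.norm_map])

theorem eq_zero_of_forall_map_eq_self (hU : U.HasLimitOn H m) (hF : F ∈ t.prod ⊤ H)
    (hfix : ∀ q, ∃ v, t.map v (U q) F = F) : F = 0 := by
  obtain ⟨a, b, ha, hb, hab, p, hlim⟩ := hU
  choose v hv using hfix
  let N : K := (a : ℂ) • F + (b : ℂ) • t.map 1 (U m) F
  have hN : ‖N‖ ≤ (a + b) * ‖F‖ := (norm_add_le _ _).trans_eq <| by
    rw [norm_smul, norm_smul, LinearIsometryEquiv.norm_map, Complex.norm_of_nonneg ha.le,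
      Complex.norm_of_nonneg hb.le, add_mul]
  have hlower (i : ℕ) : (1 - (a + b)) * ‖F‖ ^ 2 ≤ ‖⟪F, F - t.map (v (p i)) 1 N⟫_ℂ‖ := by
    have hupper : ‖⟪F, t.map (v (p i)) 1 N⟫_ℂ‖ ≤ ‖F‖ * ((a + b) * ‖F‖) :=
      (norm_inner_le_norm _ _).trans
        (mul_le_mul_of_nonneg_left (((t.map _ _).norm_map N).trans_le hN) (norm_nonneg _))
    rw [inner_sub_right]
    refine le_trans ?_ (norm_sub_norm_le _ _)
    rw [inner_self_eq_norm_sq_to_K, norm_pow, RCLike.norm_ofReal, abs_norm]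
    linarith
  have hlim₀ : Tendsto (fun i => ‖⟪F, F - t.map (v (p i)) 1 N⟫_ℂ‖) atTop (𝓝 0) := by
    simpa only [hv, inner_zero_right, norm_zero] using
      (t.weakTendsto_map_sub_map (v := fun i => v (p i)) hlim hF F).norm
  have hle : (1 - (a + b)) * ‖F‖ ^ 2 ≤ 0 := ge_of_tendsto' hlim₀ hlower
  exact norm_eq_zero.1 (pow_eq_zero_iff two_ne_zero |>.1
    ((nonpos_of_mul_nonpos_right hle (sub_pos.2 hab)).antisymm (sq_nonneg _)))

theorem eq_zero_of_map_eq_self_of_generators {U : UnitaryRep (ℤ × ℤ) M} {m : ℤ × ℤ}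
    (hU : U.HasLimitOn H m) (hF : F ∈ t.prod ⊤ H) {v₁ v₂ : L ≃ₗᵢ[ℂ] L}
    (h₁ : t.map v₁ (U (1, 0)) F = F) (h₂ : t.map v₂ (U (0, 1)) F = F) : F = 0 := by
  let S : AddSubgroup (ℤ × ℤ) :=
    { carrier := {q | ∃ v, t.map v (U q) F = F}
      zero_mem' := ⟨1, by rw [U.map_zero, map_one_one_apply]⟩
      add_mem' := by
        rintro q r ⟨v, hv⟩ ⟨w, hw⟩
        refine ⟨v * w, ?_⟩
        rw [U.map_add, ← map_map_apply, hw, hv]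
      neg_mem' := by
        rintro q ⟨v, hv⟩
        refine ⟨v⁻¹, ?_⟩
        nth_rw 1 [← hv]
        rw [map_map_apply, ← U.map_add, neg_add_cancel, inv_mul_cancel, U.map_zero,
          map_one_one_apply] }
  refine t.eq_zero_of_forall_map_eq_self hU hF fun q => ?_
  have hq : q = q.1 • (1, 0) + q.2 • (0, 1) := by ext <;> simp
  exact hq ▸ S.add_mem (S.zsmul_mem ⟨v₁, h₁⟩ _) (S.zsmul_mem ⟨v₂, h₂⟩ _)

end Fixed

section Square

variable [CompleteSpace K] (t : HilbertTensor L L K) {G : Type*} [AddCommGroup G]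
  {U : UnitaryRep G L} {H : Submodule ℂ L} {m : G} {ι : Type*} {l : Filter ι} {p : ι → G} {a b : ℂ}

theorem symSum_outer_apply (U : UnitaryRep G L) (m : G) (x : K) :
    (t.outer U U).symSum m x = t.map (U m) 1 x + t.map 1 (U m) x := by
  rw [UnitaryRep.symSum_apply]
  change t.map (U m) (U 0) x + t.map (U 0) (U m) x = _
  rw [U.map_zero]

theorem diag_outer_tens (U : UnitaryRep G L) (z : G) (f g : L) :
    (t.outer U U).diag z (t.tens f g) = t.tens (U z f) (U z g) :=
  t.outer_tens U U (z, z) f g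

theorem isInvariant_diag_prod {P Q : Submodule ℂ L} (hP : U.IsInvariant P)
    (hQ : U.IsInvariant Q) : (t.outer U U).diag.IsInvariant (t.prod P Q) := fun z =>
  t.isInvariant_prod hP hQ (z, z)

theorem weakTendsto_diag_of_mem_prod
    (hp : ∀ f ∈ H, WeakTendsto ℂ (fun i => U (p i) f) l (a • f + b • U m f)) {x : K}
    (hx : x ∈ t.prod H H) : WeakTendsto ℂ (fun i => (t.outer U U).diag (p i) x) l
      (a ^ 2 • x + (a * b) • (t.outer U U).symSum m x + b ^ 2 • (t.outer U U).diag m x) := by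
  let N : K →L[ℂ] K :=
    a ^ 2 • .id ℂ K + (a * b) • (t.outer U U).symSum m + b ^ 2 • (t.outer U U).diag.op m
  refine weakTendsto_apply_of_mem_closure_span (O := fun i => (t.outer U U).diag.op (p i)) (A := N)
    (fun i => (t.outer U U).diag.norm_op_le (p i)) ?_ hx
  rintro _ ⟨f, hf, g, hg, rfl⟩
  have hN : N (t.tens f g) = t.tens (a • f + b • U m f) (a • g + b • U m g) := by
    change a ^ 2 • t.tens f g + (a * b) • (t.outer U U).symSum m (t.tens f g) +
      b ^ 2 • (t.outer U U).diag m (t.tens f g) = _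
    simp only [symSum_outer_apply, diag_outer_tens, map_tens, LinearIsometryEquiv.coe_one, id_eq,
      map_add, map_smul, add_apply, smul_apply]
    module
  rw [hN]
  simp only [UnitaryRep.op_apply, diag_outer_tens]
  exact t.weakTendsto_tens (hp f hf) (hp g hg) (fun i => ((U (p i)).norm_map f).le)
    fun i => ((U (p i)).norm_map g).le

theorem weakTendsto_diag_of_fixed [CompleteSpace L]
    (hp : ∀ f ∈ H, WeakTendsto ℂ (fun i => U (p i) f) l (a • f + b • U m f)) {e f : L}
    (he : ∀ z, U z e = e) (hf : f ∈ H) :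
    WeakTendsto ℂ (fun i => (t.outer U U).diag (p i) (t.tens f e + t.tens e f)) l
      (a • (t.tens f e + t.tens e f) +
        b • (t.outer U U).diag m (t.tens f e + t.tens e f)) := by
  have h := (hp f hf).map (t.tens.flip e + t.tens e)
  simpa only [map_add, map_smul, add_apply, ContinuousLinearMap.flip_apply, diag_outer_tens, he]
    using h

theorem symSum_mem (hU : U.HasLimitOn H m) {C : Submodule ℂ K} [CompleteSpace C]
    (hC : (t.outer U U).diag.IsInvariant C) (hCH : C ≤ t.prod H H) {x : K} (hx : x ∈ C) :
    (t.outer U U).symSum m x ∈ C := by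
  obtain ⟨a, b, ha, hb, -, p, hp⟩ := hU
  have hlim := (t.weakTendsto_diag_of_mem_prod hp (hCH hx)).mem fun i => hC (p i) x hx
  have hab : (a * b : ℂ) ≠ 0 := by exact_mod_cast (mul_pos ha hb).ne'
  rwa [C.add_mem_iff_left (C.smul_mem _ (hC m x hx)), C.add_mem_iff_right (C.smul_mem _ hx),
    C.smul_mem_iff hab] at hlim

theorem exists_map_eq_self [CompleteSpace L] {a b : ℝ} (ha : 0 < a) (hb : 0 < b) (hab : a + b < 1)
    {x : K} (h : (a : ℂ) • x + (b : ℂ) • (t.outer U U).diag m x =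
      (a : ℂ) ^ 2 • x + (a * b : ℂ) • (t.outer U U).symSum m x +
        (b : ℂ) ^ 2 • (t.outer U U).diag m x) : ∃ v, t.map v (U m) x = x := by
  obtain rfl | hx := eq_or_ne x 0
  · exact ⟨1, map_zero _⟩
  let Z : K ≃ₗᵢ[ℂ] K := t.map (U m) 1
  let W : K ≃ₗᵢ[ℂ] K := t.map 1 (U m)
  have hWZ : (t.outer U U).diag m x = W (Z x) := by
    rw [map_map_apply, one_mul, mul_one]
    rfl
  have hcomm : W (Z x) = Z (W x) := by
    rw [map_map_apply, map_map_apply, one_mul, mul_one]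
  rw [hWZ, symSum_outer_apply] at h
  obtain ⟨c, hc, hrel⟩ := exists_apply_sub_smul_eq ha hb hab hx h
  have hc₁ : ‖(c : ℂ)‖ ≠ 1 := by
    rw [Complex.norm_of_nonneg (zero_le_one.trans hc.le)]
    exact hc.ne'
  obtain ⟨v, hv⟩ := exists_moebius_transform hc₁ (U m)
  rw [Complex.star_def, Complex.conj_ofReal] at hv
  have hvW : t.map v 1 x = W x := by
    refine sub_eq_zero.1 (eq_zero_of_eq_smul_apply hc₁ Z ?_)
    have hvZ := (t.map_left_apply_of_forall hv x).trans hrel.symm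
    rw [map_sub, map_smul, hcomm] at hvZ
    rw [map_sub, smul_sub, sub_eq_sub_iff_sub_eq_sub]
    exact hvZ
  exact ⟨v⁻¹, calc
    t.map v⁻¹ (U m) x = t.map v⁻¹ 1 (W x) := by rw [map_map_apply, mul_one, one_mul]
    _ = t.map v⁻¹ 1 (t.map v 1 x) := by rw [hvW]
    _ = x := by rw [map_map_apply, inv_mul_cancel, one_mul, map_one_one_apply]⟩

theorem eq_zero_of_intertwiner [CompleteSpace L] {U : UnitaryRep (ℤ × ℤ) L}
    (h₁₀ : U.HasLimitOn H (1, 0)) (h₀₁ : U.HasLimitOn H (0, 1)) {A : K →L[ℂ] K}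
    (hA : ∀ z x, A ((t.outer U U).diag z x) = (t.outer U U).diag z (A x)) {e f : L}
    (he : ∀ z, U z e = e) (hf : f ∈ H) (hmem : A (t.tens f e + t.tens e f) ∈ t.prod H H) :
    A (t.tens f e + t.tens e f) = 0 := by
  have hfix {m : ℤ × ℤ} (hU : U.HasLimitOn H m) :
      ∃ v, t.map v (U m) (A (t.tens f e + t.tens e f)) = A (t.tens f e + t.tens e f) := by
    obtain ⟨a, b, ha, hb, hab, p, hp⟩ := hU
    refine t.exists_map_eq_self ha hb hab
      (WeakTendsto.unique ?_ (t.weakTendsto_diag_of_mem_prod hp hmem))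
    simpa only [hA, map_add, map_smul] using (t.weakTendsto_diag_of_fixed hp he hf).map A
  obtain ⟨v₁, h₁⟩ := hfix h₁₀
  obtain ⟨v₂, h₂⟩ := hfix h₀₁
  exact t.eq_zero_of_map_eq_self_of_generators h₁₀ (t.prod_mono le_top le_rfl hmem) h₁ h₂

end Square

section Generators

variable [CompleteSpace K] (t : HilbertTensor L L K) {G : Type*} [AddCommGroup G]
  {U : UnitaryRep G L}

theorem add_swap_mem {h : L} {C : Submodule ℂ K} (hCc : IsClosed (C : Set K))
    (hC : (t.outer U U).diag.IsInvariant C)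
    (hsum : ∀ m, (t.outer U U).symSum m (t.tens h h) ∈ C) {x : K}
    (hx : x ∈ t.prod (U.cyclic h) (U.cyclic h)) : x + t.swap x ∈ C := by
  refine t.map_mem_of_mem_prod_closure_span
    (.id ℂ K + t.swap.toLinearIsometry.toContinuousLinearMap) hCc ?_ hx
  rintro _ ⟨z, rfl⟩ _ ⟨w, rfl⟩
  change t.tens (U z h) (U w h) + t.swap (t.tens (U z h) (U w h)) ∈ C
  have hmem := hC w _ (hsum (z - w))
  simpa only [symSum_outer_apply, map_tens, map_add, diag_outer_tens, LinearIsometryEquiv.coe_one,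
    id_eq, ← UnitaryRep.add_apply, add_sub_cancel, swap_tens] using hmem

theorem add_swap_mem_of_fixed {e h : L} (he : ∀ z, U z e = e) {C : Submodule ℂ K}
    (hCc : IsClosed (C : Set K)) (hC : (t.outer U U).diag.IsInvariant C)
    (hmem : t.tens h e + t.tens e h ∈ C) {x : K} (hx : x ∈ t.prod (U.cyclic h) (ℂ ∙ e)) :
    x + t.swap x ∈ C := by
  refine t.map_mem_of_mem_prod
    (.id ℂ K + t.swap.toLinearIsometry.toContinuousLinearMap) hCc (fun f hf g hg => ?_) hx
  change t.tens f g + t.swap (t.tens f g) ∈ C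
  obtain ⟨c, rfl⟩ := Submodule.mem_span_singleton.1 hg
  rw [map_smul, map_smul, swap_tens, ← smul_add]
  refine C.smul_mem c (map_mem_of_mem_closure_span (t.tens.flip e + t.tens e) hCc ?_ hf)
  rintro _ ⟨z, rfl⟩
  simpa only [map_add, diag_outer_tens, he, add_apply, ContinuousLinearMap.flip_apply] using
    hC z _ hmem

theorem add_swap_mem_of_orthogonal {P : Submodule ℂ L} [P.HasOrthogonalProjection]
    {C : Submodule ℂ K} (hCc : IsClosed (C : Set K))
    (h : ∀ x ∈ t.prod Pᗮ P, x + t.swap x ∈ C) (h' : ∀ x ∈ t.prod Pᗮ Pᗮ, x + t.swap x ∈ C) {x : K}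
    (hx : x ∈ (t.prod P P)ᗮ) : x + t.swap x ∈ C := by
  let A : K →L[ℂ] K := .id ℂ K + t.swap.toLinearIsometry.toContinuousLinearMap
  have hl : t.prod Pᗮ ⊤ ≤ C.comap A.toLinearMap := by
    refine t.prod_le (hCc.preimage A.continuous) fun f hf g _ => ?_
    rw [← P.starProjection_add_starProjection_orthogonal g, map_add]
    exact Submodule.add_mem _
      (h _ (t.tens_mem_prod hf (Submodule.starProjection_apply_mem _ _)))
      (h' _ (t.tens_mem_prod hf (Submodule.starProjection_apply_mem _ _)))
  refine t.orthogonal_prod_le (C := C.comap A.toLinearMap) (hCc.preimage A.continuous) hl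
    (fun y hy => ?_) hx
  have hswap : t.swap y + t.swap (t.swap y) ∈ C := hl (t.swap_mem_prod hy)
  rwa [swap_swap, add_comm] at hswap

variable {U : UnitaryRep (ℤ × ℤ) L} {H : Submodule ℂ L}

theorem symSum_mem_of_generators (h₁₀ : U.HasLimitOn H (1, 0)) (h₀₁ : U.HasLimitOn H (0, 1))
    (h₁₁ : U.HasLimitOn H (1, 1)) {C : Submodule ℂ K} [CompleteSpace C]
    (hC : (t.outer U U).diag.IsInvariant C) (hCH : C ≤ t.prod H H) (m : ℤ × ℤ) {x : K}
    (hx : x ∈ C) : (t.outer U U).symSum m x ∈ C := by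
  refine mem_of_generators (s := {m | ∀ x ∈ C, (t.outer U U).symSum m x ∈ C}) (fun x hx => ?_)
    (fun m hm x hx => ?_) (fun m hm n hn hmn x hx => ?_) (fun _ => t.symSum_mem h₁₀ hC hCH)
    (fun _ => t.symSum_mem h₀₁ hC hCH) (fun _ => t.symSum_mem h₁₁ hC hCH) m x hx
  · rw [UnitaryRep.symSum_apply, Prod.mk_zero_zero, UnitaryRep.zero_apply]
    exact C.add_mem hx hx
  · rw [UnitaryRep.symSum_neg]
    exact hC _ _ (hm x hx)
  · rw [UnitaryRep.symSum_add]
    exact C.sub_mem (hm _ (hn x hx)) (hC _ _ (hmn x hx))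

theorem tens_add_tens_mem_cyclic [CompleteSpace L] {e h : L} (he : ∀ z, U z e = e)
    (hH : U.cyclic h = (ℂ ∙ e)ᗮ) (h₁₀ : U.HasLimitOn (U.cyclic h) (1, 0))
    (h₀₁ : U.HasLimitOn (U.cyclic h) (0, 1)) :
    t.tens h e + t.tens e h ∈
      (t.outer U U).diag.cyclic (t.tens h e + t.tens e h + t.tens h h) := by
  let C := (t.outer U U).diag.cyclic (t.tens h e + t.tens e h + t.tens h h)
  let P := t.prod (U.cyclic h) (U.cyclic h)
  have hh : h ∈ U.cyclic h := U.self_mem_cyclic h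
  have hhe : ⟪h, e⟫_ℂ = 0 :=
    Submodule.inner_left_of_mem_orthogonal (Submodule.mem_span_singleton_self e) (hH ▸ hh)
  have hPinv : (t.outer U U).diag.IsInvariant P :=
    t.isInvariant_diag_prod (U.isInvariant_cyclic h) (U.isInvariant_cyclic h)
  refine mem_of_add_mem_of_inner_starProjection_eq_zero C (UnitaryRep.self_mem_cyclic _ _) ?_ ?_
  · rw [inner_add_right, inner_tens, inner_tens, hhe, mul_zero, zero_mul, add_zero]
  have hzero : P.starProjection (C.starProjection (t.tens h e + t.tens e h)) = 0 :=
    t.eq_zero_of_intertwiner h₁₀ h₀₁ (A := P.starProjection ∘L C.starProjection)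
      (fun z x => by
        rw [ContinuousLinearMap.comp_apply, ContinuousLinearMap.comp_apply,
          (UnitaryRep.isInvariant_cyclic _ _).starProjection_apply, hPinv.starProjection_apply])
      he hh (Submodule.starProjection_apply_mem _ _)
  exact Submodule.inner_right_of_mem_orthogonal (t.tens_mem_prod hh hh)
    ((Submodule.starProjection_apply_eq_zero_iff P).1 hzero)

theorem flipPart_swap_eq_cyclic [CompleteSpace L] {e h : L} (he : ∀ z, U z e = e)
    (hH : U.cyclic h = (ℂ ∙ e)ᗮ) (h₁₀ : U.HasLimitOn (U.cyclic h) (1, 0))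
    (h₀₁ : U.HasLimitOn (U.cyclic h) (0, 1)) (h₁₁ : U.HasLimitOn (U.cyclic h) (1, 1)) :
    flipPart t.swap (t.prod (ℂ ∙ e) (ℂ ∙ e))ᗮ 1 =
      (t.outer U U).diag.cyclic (t.tens h e + t.tens e h + t.tens h h) := by
  set C := (t.outer U U).diag.cyclic (t.tens h e + t.tens e h + t.tens h h)
  have hCc : IsClosed (C : Set K) := UnitaryRep.isClosed_cyclic _ _
  have hC : (t.outer U U).diag.IsInvariant C := UnitaryRep.isInvariant_cyclic _ _
  have he_mem : e ∈ ℂ ∙ e := Submodule.mem_span_singleton_self e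
  have hh : h ∈ (ℂ ∙ e)ᗮ := hH ▸ U.self_mem_cyclic h
  have hE : U.IsInvariant (ℂ ∙ e) := UnitaryRep.isInvariant_span_singleton he
  have hsum : t.tens h e + t.tens e h ∈ C := t.tens_add_tens_mem_cyclic he hH h₁₀ h₀₁
  have hhh : t.tens h h ∈ C := (C.add_mem_iff_right hsum).1 (UnitaryRep.self_mem_cyclic _ _)
  have symSum_tens_mem (m : ℤ × ℤ) : (t.outer U U).symSum m (t.tens h h) ∈ C :=
    UnitaryRep.cyclic_le hCc hC hhh <|
      t.symSum_mem_of_generators h₁₀ h₀₁ h₁₁ (UnitaryRep.isInvariant_cyclic _ (t.tens h h))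
        (UnitaryRep.cyclic_le (t.isClosed_prod _ _)
          (t.isInvariant_diag_prod (U.isInvariant_cyclic h) (U.isInvariant_cyclic h))
          (t.tens_mem_prod (U.self_mem_cyclic h) (U.self_mem_cyclic h)))
        m (UnitaryRep.self_mem_cyclic _ _)
  refine le_antisymm (fun x hx => ?_) (UnitaryRep.cyclic_le
    (isClosed_flipPart (Submodule.isClosed_orthogonal _))
    ((t.isInvariant_diag_prod hE hE).orthogonal.flipPart (fun z => t.swap_outer_apply U z z) 1)
    (mem_flipPart.2 ⟨?_, ?_⟩))
  · obtain ⟨hxE, hSx⟩ := mem_flipPart.1 hx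
    have hmem : x + t.swap x ∈ C := t.add_swap_mem_of_orthogonal hCc
      (fun y hy => t.add_swap_mem_of_fixed he hCc hC hsum (hH ▸ hy))
      (fun y hy => t.add_swap_mem hCc hC symSum_tens_mem (hH ▸ hy)) hxE
    rwa [hSx, one_smul, ← two_smul ℂ x, C.smul_mem_iff two_ne_zero] at hmem
  · have hle {P Q : Submodule ℂ L} (hPQ : P ⟂ (ℂ ∙ e) ∨ Q ⟂ (ℂ ∙ e)) {f g : L} (hf : f ∈ P)
        (hg : g ∈ Q) : t.tens f g ∈ (t.prod (ℂ ∙ e) (ℂ ∙ e))ᗮ :=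
      t.prod_isOrtho hPQ (t.tens_mem_prod hf hg)
    exact Submodule.add_mem _ (Submodule.add_mem _ (hle (.inl le_rfl) hh he_mem)
      (hle (.inr le_rfl) he_mem hh)) (hle (.inl le_rfl) hh hh)
  · rw [map_add, map_add, swap_tens, swap_tens, swap_tens, one_smul, add_comm (t.tens e h)]

end Generators

section Decomposition

variable [CompleteSpace K] (t : HilbertTensor L L K)

theorem antiSum_eq_zero_of_mem_prod {G : Type*} [AddCommGroup G] {U : UnitaryRep G L}
    {P : Submodule ℂ L} (hP : ∀ z, ∀ f ∈ P, U z f = f) (m : G) {x : K} (hx : x ∈ t.prod P P) :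
    (t.outer U U).antiSum m x = 0 := by
  refine t.map_mem_of_mem_prod _ (C := ⊥) isClosed_singleton (fun f hf g hg => ?_) hx
  rw [Submodule.mem_bot, UnitaryRep.antiSum_apply, outer_tens, outer_tens, hP _ f hf, hP _ f hf,
    hP _ g hg, hP _ g hg, sub_self]

variable {U : UnitaryRep (ℤ × ℤ) L} {m : ℤ × ℤ} {x : K}

theorem mem_orthogonal_prod_top_of_antiSum_eq_zero {H : Submodule ℂ L} (hU : U.HasLimitOn H m)
    (hH : U.IsInvariant H) (h₁₀ : (t.outer U U).antiSum (1, 0) x = 0)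
    (h₀₁ : (t.outer U U).antiSum (0, 1) x = 0) : x ∈ (t.prod ⊤ H)ᗮ := by
  set V := t.outer U U
  set y := (t.prod ⊤ H).starProjection x
  have hinv : V.IsInvariant (t.prod ⊤ H) :=
    t.isInvariant_prod (fun _ _ _ => Submodule.mem_top) hH
  have hfix {q : ℤ × ℤ} (hq : V.antiSum q x = 0) : t.map (U (-q)) (U q) y = y := by
    have hVx : V (q, 0) x = V (0, q) x := sub_eq_zero.1 hq
    have hVy : V (q, 0) y = V (0, q) y := by
      rw [← hinv.starProjection_apply, hVx, hinv.starProjection_apply]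
    calc t.map (U (-q)) (U q) y = V (-q, 0) (V (0, q) y) := by
          rw [← V.add_apply, Prod.mk_add_mk, add_zero, zero_add]
          rfl
      _ = V (-(q, 0)) (V (q, 0) y) := by rw [hVy, Prod.neg_mk q, neg_zero]
      _ = y := V.neg_apply_apply _ _
  rw [← Submodule.starProjection_apply_eq_zero_iff]
  exact t.eq_zero_of_map_eq_self_of_generators hU (Submodule.starProjection_apply_mem _ _)
    (hfix h₁₀) (hfix h₀₁)

theorem mem_prod_of_antiSum_eq_zero {P : Submodule ℂ L} [P.HasOrthogonalProjection]
    (hU : U.HasLimitOn Pᗮ m) (hP : U.IsInvariant P)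
    (h₁₀ : (t.outer U U).antiSum (1, 0) x = 0) (h₀₁ : (t.outer U U).antiSum (0, 1) x = 0) :
    x ∈ t.prod P P := by
  have hswap {q : ℤ × ℤ} (hq : (t.outer U U).antiSum q x = 0) :
      (t.outer U U).antiSum q (t.swap x) = 0 := by
    rw [UnitaryRep.antiSum_apply_of_swap _ (t.swap_outer_apply U), hq, map_zero, smul_zero]
  have hr : t.prod ⊤ Pᗮ ≤ (ℂ ∙ x)ᗮ := fun y hy =>
    Submodule.mem_orthogonal_singleton_iff_inner_left.2
      (t.mem_orthogonal_prod_top_of_antiSum_eq_zero hU hP.orthogonal h₁₀ h₀₁ y hy)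
  have hl : t.prod Pᗮ ⊤ ≤ (ℂ ∙ x)ᗮ := fun y hy => by
    rw [Submodule.mem_orthogonal_singleton_iff_inner_left, ← t.swap.inner_map_map]
    exact t.mem_orthogonal_prod_top_of_antiSum_eq_zero hU hP.orthogonal (hswap h₁₀) (hswap h₀₁) _
      (t.swap_mem_prod hy)
  rw [← Submodule.orthogonal_orthogonal (t.prod P P)]
  exact Submodule.orthogonal_le (t.orthogonal_prod_le (Submodule.isClosed_orthogonal _) hl hr)
    (Submodule.le_orthogonal_orthogonal _ (Submodule.mem_span_singleton_self x))

theorem exists_fin_two_decomposition [CompleteSpace L] {e h : L} (he : ∀ z, U z e = e)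
    (hH : U.cyclic h = (ℂ ∙ e)ᗮ) (h₁₀ : U.HasLimitOn (ℂ ∙ e)ᗮ (1, 0))
    (h₀₁ : U.HasLimitOn (ℂ ∙ e)ᗮ (0, 1)) (h₁₁ : U.HasLimitOn (ℂ ∙ e)ᗮ (1, 1)) :
    ∃ C : Fin 2 → Submodule ℂ K,
      (∀ i, IsCyclicSubspace (t.outer U U).diag.isometries (C i)) ∧
      (Pairwise fun i j => C i ⟂ C j) ∧ (⨆ i, C i) = (t.prod (ℂ ∙ e) (ℂ ∙ e))ᗮ ∧
      ∀ i j, RestrictionsIsomorphic (t.outer U U).diag.isometries (C i) (C j) := by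
  set V := t.outer U U
  let A : K →L[ℂ] K := normalJoin (V.antiSum (1, 0)) (V.antiSum (0, 1))
  have hnormal (m : ℤ × ℤ) : IsStarNormal (V.antiSum m) := V.isStarNormal_antiSum m
  have hcomm : Commute (V.antiSum (1, 0)) (V.antiSum (0, 1)) := V.commute_antiSum _ _
  have hcomm' : Commute (V.antiSum (1, 0)) (star (V.antiSum (0, 1))) :=
    V.star_antiSum (0, 1) ▸ V.commute_antiSum _ _
  have hfix (z : ℤ × ℤ) (f : L) (hf : f ∈ ℂ ∙ e) : U z f = f := by
    obtain ⟨c, rfl⟩ := Submodule.mem_span_singleton.1 hf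
    rw [map_smul, he]
  have hker : A.ker = t.prod (ℂ ∙ e) (ℂ ∙ e) := by
    ext x
    refine (mem_ker_normalJoin (hnormal _) hcomm hcomm').trans ⟨fun hx => ?_, fun hx => ?_⟩
    · exact t.mem_prod_of_antiSum_eq_zero h₁₀ (UnitaryRep.isInvariant_span_singleton he) hx.1 hx.2
    · exact ⟨t.antiSum_eq_zero_of_mem_prod hfix _ hx, t.antiSum_eq_zero_of_mem_prod hfix _ hx⟩
  have hAV (z : ℤ × ℤ) (x : K) : A (V.diag z x) = V.diag z (A x) := by
    simpa only [one_smul] using normalJoin_apply_of_semiconj one_ne_zero (u := V.diag z)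
      (fun x => (V.antiSum_diag_apply _ z x).trans (one_smul ℂ _).symm)
      (fun x => (V.antiSum_diag_apply _ z x).trans (one_smul ℂ _).symm) x
  rw [← hker]
  refine UnitaryRep.exists_fin_two_decomposition_of_flip t.swap_swap
    (fun z => t.swap_outer_apply U z z)
    (isStarNormal_normalJoin (hnormal _) (hnormal _) hcomm hcomm') hAV
    (normalJoin_apply_of_semiconj (neg_ne_zero.2 one_ne_zero)
      (V.antiSum_apply_of_swap (t.swap_outer_apply U) _)
      (V.antiSum_apply_of_swap (t.swap_outer_apply U) _)) ?_
  rw [hker, t.flipPart_swap_eq_cyclic he hH (hH ▸ h₁₀) (hH ▸ h₀₁) (hH ▸ h₁₁)]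
  exact ⟨_, rfl⟩

end Decomposition

end HilbertTensor

section Products

theorem ae_eq_zero_of_forall_setIntegral_prod_eq_zero {X Y E : Type*} [MeasurableSpace X]
    [MeasurableSpace Y] [NormedAddCommGroup E] [NormedSpace ℝ E] [CompleteSpace E]
    {κ : Measure (X × Y)} {F : X × Y → E} (hF : Integrable F κ)
    (h : ∀ s t, MeasurableSet s → MeasurableSet t → ∫ x in s ×ˢ t, F x ∂κ = 0) :
    F =ᵐ[κ] 0 := by
  have huniv : ∫ x, F x ∂κ = 0 := by
    simpa only [Set.univ_prod_univ, setIntegral_univ] using h _ _ .univ .univ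
  have hzero (s : Set (X × Y)) (hs : MeasurableSet s) : ∫ x in s, F x ∂κ = 0 := by
    induction s, hs using MeasurableSpace.induction_on_inter generateFrom_prod.symm
      isPiSystem_prod with
    | empty => rw [setIntegral_empty]
    | basic s hs =>
      obtain ⟨s, hs, t, ht, rfl⟩ := hs
      exact h s t hs ht
    | compl s hs ih => rw [← huniv, ← integral_add_compl hs hF, ih, zero_add]
    | iUnion f hd hf ih => rw [integral_iUnion hf hd hF.integrableOn, tsum_congr ih, tsum_zero]
  exact hF.ae_eq_zero_of_forall_setIntegral_eq_zero fun s hs _ => hzero s hs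

variable {X Y : Type*} [MeasurableSpace X] [MeasurableSpace Y] {μ : Measure X} {ν : Measure Y}

theorem memLp_mul_prod {f : X → ℂ} {g : Y → ℂ} (hf : MemLp f 2 μ) (hg : MemLp g 2 ν) :
    MemLp (fun x : X × Y => f x.1 * g x.2) 2 (μ.prod ν) := by
  have hmeas : AEStronglyMeasurable (fun x : X × Y => f x.1 * g x.2) (μ.prod ν) :=
    hf.1.comp_fst.mul hg.1.comp_snd
  rw [memLp_two_iff_integrable_sq_norm hmeas]
  simpa only [norm_mul, mul_pow] using
    ((memLp_two_iff_integrable_sq_norm hf.1).1 hf).mul_prod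
      ((memLp_two_iff_integrable_sq_norm hg.1).1 hg)

/-- The function `(x, y) ↦ f x * g y` in `L²(μ × ν)`. -/
def lpMul (f : Lp ℂ 2 μ) (g : Lp ℂ 2 ν) : Lp ℂ 2 (μ.prod ν) :=
  (memLp_mul_prod (Lp.memLp f) (Lp.memLp g)).toLp _

theorem coeFn_lpMul (f : Lp ℂ 2 μ) (g : Lp ℂ 2 ν) :
    lpMul f g =ᵐ[μ.prod ν] fun x => f x.1 * g x.2 :=
  MemLp.coeFn_toLp _

theorem lpMul_eq_of_ae {f : Lp ℂ 2 μ} {g : Lp ℂ 2 ν} {f' : X → ℂ} {g' : Y → ℂ}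
    (hf : f =ᵐ[μ] f') (hg : g =ᵐ[ν] g') {F : Lp ℂ 2 (μ.prod ν)}
    (h : F =ᵐ[μ.prod ν] fun x => f' x.1 * g' x.2) : lpMul f g = F := by
  refine Lp.ext ((coeFn_lpMul f g).trans (EventuallyEq.trans ?_ h.symm))
  filter_upwards [Measure.quasiMeasurePreserving_fst.ae hf,
    Measure.quasiMeasurePreserving_snd.ae hg] with x hx hy
  rw [hx, hy]

variable [SFinite ν]

variable (μ ν) in
/-- The map `lpMul`, bundled as a bilinear map. -/
def lpMulBilin : Lp ℂ 2 μ →ₗ[ℂ] Lp ℂ 2 ν →ₗ[ℂ] Lp ℂ 2 (μ.prod ν) :=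
  LinearMap.mk₂ ℂ lpMul
    (fun f f' g => by
      refine lpMul_eq_of_ae (Lp.coeFn_add f f') .rfl ?_
      filter_upwards [Lp.coeFn_add (lpMul f g) (lpMul f' g), coeFn_lpMul f g,
        coeFn_lpMul f' g] with x hadd hf hf'
      rw [hadd, Pi.add_apply, Pi.add_apply, hf, hf', add_mul])
    (fun c f g => by
      refine lpMul_eq_of_ae (Lp.coeFn_smul c f) .rfl ?_
      filter_upwards [Lp.coeFn_smul c (lpMul f g), coeFn_lpMul f g] with x hsmul hf
      rw [hsmul, Pi.smul_apply, Pi.smul_apply, hf, smul_mul_assoc])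
    (fun f g g' => by
      refine lpMul_eq_of_ae .rfl (Lp.coeFn_add g g') ?_
      filter_upwards [Lp.coeFn_add (lpMul f g) (lpMul f g'), coeFn_lpMul f g,
        coeFn_lpMul f g'] with x hadd hg hg'
      rw [hadd, Pi.add_apply, Pi.add_apply, hg, hg', mul_add])
    (fun c f g => by
      refine lpMul_eq_of_ae .rfl (Lp.coeFn_smul c g) ?_
      filter_upwards [Lp.coeFn_smul c (lpMul f g), coeFn_lpMul f g] with x hsmul hg
      rw [hsmul, Pi.smul_apply, Pi.smul_apply, hg, mul_smul_comm])

theorem inner_lpMul [SFinite μ] (f f' : Lp ℂ 2 μ) (g g' : Lp ℂ 2 ν) :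
    ⟪lpMul f g, lpMul f' g'⟫_ℂ = ⟪f, f'⟫_ℂ * ⟪g, g'⟫_ℂ := by
  rw [L2.inner_def, L2.inner_def, L2.inner_def, ← integral_prod_mul]
  refine integral_congr_ae ?_
  filter_upwards [coeFn_lpMul f g, coeFn_lpMul f' g'] with x h h'
  rw [h, h']
  simp only [RCLike.inner_apply, map_mul]
  ring

end Products

section FiniteMeasure

variable {X Y : Type*} [MeasurableSpace X] [MeasurableSpace Y] {μ : Measure X} {ν : Measure Y}
  [IsFiniteMeasure μ] [IsFiniteMeasure ν]

theorem lpMul_indicatorConstLp_one {s : Set X} {t : Set Y} (hs : MeasurableSet s)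
    (ht : MeasurableSet t) :
    lpMul (indicatorConstLp 2 hs (measure_ne_top μ s) (1 : ℂ))
      (indicatorConstLp 2 ht (measure_ne_top ν t) (1 : ℂ)) =
    indicatorConstLp 2 (hs.prod ht) (measure_ne_top (μ.prod ν) _) (1 : ℂ) := by
  refine lpMul_eq_of_ae indicatorConstLp_coeFn indicatorConstLp_coeFn
    (indicatorConstLp_coeFn.trans (.of_forall fun x => ?_))
  exact Set.indicator_prod_one

theorem eq_zero_of_forall_inner_lpMul_eq_zero {F : Lp ℂ 2 (μ.prod ν)}
    (h : ∀ (f : Lp ℂ 2 μ) (g : Lp ℂ 2 ν), ⟪lpMul f g, F⟫_ℂ = 0) : F = 0 := by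
  refine (Lp.eq_zero_iff_ae_eq_zero).2 (ae_eq_zero_of_forall_setIntegral_prod_eq_zero
    ((Lp.memLp F).integrable one_le_two) fun s t hs ht => ?_)
  rw [← L2.inner_indicatorConstLp_one (𝕜 := ℂ) (hs.prod ht) (measure_ne_top (μ.prod ν) _) F,
    ← lpMul_indicatorConstLp_one hs ht, h]

variable (μ ν) in
/-- `L²(μ × ν)` as the Hilbert tensor product of `L²(μ)` and `L²(ν)`. -/
def lpTensor : HilbertTensor (Lp ℂ 2 μ) (Lp ℂ 2 ν) (Lp ℂ 2 (μ.prod ν)) :=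
  .ofBilinear (B := lpMulBilin μ ν) inner_lpMul fun _ => eq_zero_of_forall_inner_lpMul_eq_zero

theorem lpTensor_tens (f : Lp ℂ 2 μ) (g : Lp ℂ 2 ν) : (lpTensor μ ν).tens f g = lpMul f g :=
  HilbertTensor.ofBilinear_tens _ _ f g

theorem lpMul_const_one :
    lpMul (Lp.const 2 μ (1 : ℂ)) (Lp.const 2 ν (1 : ℂ)) = Lp.const 2 (μ.prod ν) (1 : ℂ) :=
  lpMul_eq_of_ae (Lp.coeFn_const 2 μ 1) (Lp.coeFn_const 2 ν 1)
    ((Lp.coeFn_const 2 (μ.prod ν) 1).trans (.of_forall fun _ => (one_mul 1).symm))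

theorem prod_constants :
    (lpTensor μ ν).prod (constants μ) (constants ν) = constants (μ.prod ν) := by
  rw [constants, constants, HilbertTensor.prod_span_singleton, lpTensor_tens, lpMul_const_one,
    constants]

end FiniteMeasure

namespace Action

variable {X : Type*} [MeasurableSpace X] {μ : Measure X} (T : Action μ)

theorem coeFn_koopman (z : ℤ × ℤ) (f : Lp ℂ 2 μ) : T.koopman z f =ᵐ[μ] f ∘ T.toFun z :=
  Lp.coeFn_compMeasurePreserving f (T.measurePreserving z)

theorem koopman_zero (f : Lp ℂ 2 μ) : T.koopman 0 f = f := by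
  refine Lp.ext ((T.coeFn_koopman 0 f).trans ?_)
  filter_upwards [T.map_zero] with x hx
  rw [Function.comp_apply, hx, id]

theorem koopman_add (z w : ℤ × ℤ) (f : Lp ℂ 2 μ) :
    T.koopman (z + w) f = T.koopman z (T.koopman w f) := by
  rw [add_comm]
  refine Lp.ext ((T.coeFn_koopman (w + z) f).trans ?_)
  filter_upwards [T.map_add w z, T.coeFn_koopman z (T.koopman w f),
    (T.measurePreserving z).quasiMeasurePreserving.ae (T.coeFn_koopman w f)] with x hadd hz hw
  rw [hz, Function.comp_apply, Function.comp_apply, hadd, hw, Function.comp_apply,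
    Function.comp_apply]

/-- The unitary representation of `ℤ²` on `L²(μ)` formed by the operators `f ↦ f ∘ T^z`. -/
def koopmanRep : UnitaryRep (ℤ × ℤ) (Lp ℂ 2 μ) where
  toFun z :=
    { T.koopman z with
      invFun := T.koopman (-z)
      left_inv := fun f => by
        change T.koopman (-z) (T.koopman z f) = f
        rw [← koopman_add, neg_add_cancel, koopman_zero]
      right_inv := fun f => by
        change T.koopman z (T.koopman (-z) f) = f
        rw [← koopman_add, add_neg_cancel, koopman_zero] }
  map_zero := LinearIsometryEquiv.ext T.koopman_zero
  map_add z w := LinearIsometryEquiv.ext (T.koopman_add z w)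

theorem koopmanRep_const_one [IsFiniteMeasure μ] (z : ℤ × ℤ) :
    T.koopmanRep z (Lp.const 2 μ 1) = Lp.const 2 μ 1 :=
  rfl

theorem koopmanRep_hasLimitOn [IsFiniteMeasure μ] {m : ℤ × ℤ} {a b c : ℝ} (ha : 0 < a)
    (hb : 0 < b) (hc : 0 < c) (hsum : a + b + c = 1)
    (hlim : HasWeakLimit T.koopman ((a : ℂ) • ContinuousLinearMap.id ℂ (Lp ℂ 2 μ)
        + (b : ℂ) • (T.koopman m).toContinuousLinearMap + (c : ℂ) • Theta μ)) :
    T.koopmanRep.HasLimitOn (L20 μ) m := by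
  obtain ⟨p, hp⟩ := hlim
  refine ⟨a, b, ha, hb, by linarith, p, fun f hf g => ?_⟩
  have hΘ : Theta μ f = 0 := (Submodule.starProjection_apply_eq_zero_iff _).2 hf
  have hg := hp f g
  simp only [add_apply, smul_apply, hΘ, smul_zero, add_zero] at hg
  exact hg

theorem koopman_diag_lpMul [SFinite μ] (z : ℤ × ℤ) (f g : Lp ℂ 2 μ) :
    T.diag.koopman z (lpMul f g) = lpMul (T.koopman z f) (T.koopman z g) :=
  (lpMul_eq_of_ae (T.coeFn_koopman z f) (T.coeFn_koopman z g) <|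
    (T.diag.coeFn_koopman z _).trans <|
      (T.diag.measurePreserving z).quasiMeasurePreserving.ae (coeFn_lpMul f g)).symm

theorem koopmanRep_diag [IsFiniteMeasure μ] :
    T.diag.koopman = ((lpTensor μ μ).outer T.koopmanRep T.koopmanRep).diag.isometries := by
  suffices h : ∀ z, T.diag.koopmanRep z =
      ((lpTensor μ μ).outer T.koopmanRep T.koopmanRep).diag z from
    funext fun z => congrArg LinearIsometryEquiv.toLinearIsometry (h z)
  refine fun z => (lpTensor μ μ).isometryEquiv_ext_tens fun f g => ?_
  rw [HilbertTensor.diag_outer_tens, lpTensor_tens, lpTensor_tens]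
  exact T.koopman_diag_lpMul z f g

end Action

end Z2Spectrum

end

theorem mainTheorem1_general {X : Type*} [MeasurableSpace X] (μ : Measure X)
    [IsFiniteMeasure μ] (T : Z2Spectrum.Action μ) (hsimple : T.HasSimpleSpectrum)
    (a b c : Fin 3 → ℝ) (ha : ∀ j, 0 < a j) (hb : ∀ j, 0 < b j) (hc : ∀ j, 0 < c j)
    (hsum : ∀ j, a j + b j + c j = 1)
    (hlim : ∀ j : Fin 3, Z2Spectrum.HasWeakLimit T.koopman
      (((a j : ℝ) : ℂ) • ContinuousLinearMap.id ℂ (Lp ℂ 2 μ)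
        + ((b j : ℝ) : ℂ) •
          (T.koopman ((![(1, 0), (0, 1), (1, 1)] : Fin 3 → ℤ × ℤ) j)).toContinuousLinearMap
        + ((c j : ℝ) : ℂ) • Z2Spectrum.Theta μ)) :
    T.diag.HasHomogeneousSpectrum 2 := by
  obtain ⟨h, hh⟩ := hsimple
  have hlimit (j : Fin 3) :
      T.koopmanRep.HasLimitOn (Z2Spectrum.L20 μ)
        ((![(1, 0), (0, 1), (1, 1)] : Fin 3 → ℤ × ℤ) j) :=
    T.koopmanRep_hasLimitOn (ha j) (hb j) (hc j) (hsum j) (hlim j)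
  rw [Z2Spectrum.Action.HasHomogeneousSpectrum, T.koopmanRep_diag, Z2Spectrum.L20,
    ← Z2Spectrum.prod_constants]
  exact (Z2Spectrum.lpTensor μ μ).exists_fin_two_decomposition T.koopmanRep_const_one hh
    (hlimit 0) (hlimit 1) (hlimit 2)

theorem mainTheorem1 {X : Type*} [MeasurableSpace X] (μ : Measure X) [IsProbabilityMeasure μ]
    (T : Z2Spectrum.Action μ) (hT : T.IsTotallyErgodic) (hsimple : T.HasSimpleSpectrum)
    (a b c : Fin 3 → ℝ) (ha : ∀ j, 0 < a j) (hb : ∀ j, 0 < b j) (hc : ∀ j, 0 < c j)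
    (hsum : ∀ j, a j + b j + c j = 1)
    (hlim : ∀ j : Fin 3, Z2Spectrum.HasWeakLimit T.koopman
      (((a j : ℝ) : ℂ) • ContinuousLinearMap.id ℂ (Lp ℂ 2 μ)
        + ((b j : ℝ) : ℂ) •
          (T.koopman ((![(1, 0), (0, 1), (1, 1)] : Fin 3 → ℤ × ℤ) j)).toContinuousLinearMap
        + ((c j : ℝ) : ℂ) • Z2Spectrum.Theta μ)) :
    T.diag.HasHomogeneousSpectrum 2 :=
  mainTheorem1_general μ T hsimple a b c ha hb hc hsum hlim
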